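/- Let $(M,\omega)$ be a symplectic manifold and let $(L,\nabla)\to M$ be a prequantum line bundle, i.e. a smooth Hermitian complex line bundle with compatible connection satisfying $[\nabla_X,\nabla_Y]-\nabla_{[X,Y]}=i\,\omega(X,Y)$. Let $P\subset TM$ be a singular real polarization: a singular subbundle, pointwise spanned by its local smooth sections, whose sheaf of smooth sections $\mathfrak F_P$ is involutive and locally finitely generated over $C^\infty$, and such that $P_x\subset T_xM$ is Lagrangian for all $x$ in a dense open subset of $M$. Let $\mathscr S_P$ be the sheaf $\mathscr S_P(U)=\{s\in\Gamma(U,L) : \nabla_Xs=0\ \forall X\in\mathfrak F_P(U)\}$ and let $$Q_{shf}(M,P)=\bigoplus_{n\ge 0}\check H^n(M,\mathscr S_P),$$ where $\check H^n$ is Čech cohomology, the direct limit over all open covers. Let $\Phi:M\to M$ be a symplectomorphism and let $\Phi(P)_x=\Phi^{-1}_*(P_{\Phi(x)})$. A trivialization cover $(\mathscr U,s)$ of $L$ is an open cover $\mathscr U=\{U_\alpha\}$ with non-vanishing smooth sections $s_\alpha\in\Gamma(U_\alpha,L)$; its local data are the functions $\lambda_{\alpha\beta}$ and complex one-forms $\theta_\alpha$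 with $s_\alpha=\lambda_{\alpha\beta}s_\beta$ and $\theta_\alpha(X)s_\alpha=-i\nabla_Xs_\alpha$. A trivialization cover $(\Phi^*\mathscr U,t)$ over $\Phi^*\mathscr U=\{\Phi^{-1}(U_\alpha)\}$ is complementary to $(\mathscr U,s)$ if its local data are $\lambda_{\alpha\beta}\circ\Phi$ and $\Phi^*\theta_\alpha$. Suppose that the Čech cohomology $\check H^1(M,\underline{\mathbb C}^\times)$ with coefficients in the constant sheaf vanishes. Then $\Phi(P)$ is a singular real polarization, and $\Phi$ induces an isomorphism of sheaf quantizations $Q_{shf}(M,P)\to Q_{shf}(M,\Phi(P))$ in the following sense. Trivialization covers of $L$ exist, every trivialization cover $(\mathscr U,s)$ has a complementary trivialization cover, and for every complementary pair $(\mathscr U,s)$, $(\Phi^*\mathscr U,t)$ there is a $\mathbb C$-linear isomorphism $$Q_{shf}(M,P)\xrightarrow{\ \cong\ }Q_{shf}(M,\Phi(P))$$ which, for every $n$, every open cover $\mathscr V$ of $M$ and every Čech cocycle $c=\{c_A\}\in\check Z^n(\mathscr V,\mathscr S_P)$, sends the class of $c$ in $\check H^n(M,\mathscr S_P)$ to the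 class in $\check H^n(M,\mathscr S_{\Phi(P)})$ of the cocycle $c'\in\check Z^n(\Phi^*\mathscr V,\mathscr S_{\Phi(P)})$ given by $c'_A=\big(\tfrac{c_A}{s_\alpha}\circ\Phi\big)\,t_\alpha$ wherever $\Phi^{-1}(U_\alpha)$ meets the domain of $c'_A$. -/

import Mathlib

open scoped Manifold ContDiff Topology DirectSum
open CategoryTheory TopologicalSpace Opposite Bundle

set_option linter.unusedSectionVars false

noncomputable section

/-! ## Čech cohomology of a presheaf of modules -/

namespace Cech

universe u v w

/-- An open cover of `X`, as an indexed family. -/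
structure OpenCover (X : Type u) [TopologicalSpace X] where
  ι : Type u
  U : ι → Opens X
  covers : ∀ x, ∃ i, x ∈ U i

namespace OpenCover

variable {X Y : Type u} [TopologicalSpace X] [TopologicalSpace Y]

/-- The finite intersection `U_{A 0} ∩ ⋯ ∩ U_{A n}`. -/
def inter (𝒰 : OpenCover X) {n : ℕ} (A : Fin (n + 1) → 𝒰.ι) : Opens X :=
  ⟨⋂ j, (𝒰.U (A j) : Set X), isOpen_iInter_of_finite fun j => (𝒰.U (A j)).isOpen⟩

lemma mem_inter (𝒰 : OpenCover X) {n : ℕ} (A : Fin (n + 1) → 𝒰.ι) (x : X) :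
    x ∈ 𝒰.inter A ↔ ∀ j, x ∈ 𝒰.U (A j) := Set.mem_iInter

lemma inter_le_face (𝒰 : OpenCover X) {n : ℕ} (A : Fin (n + 2) → 𝒰.ι) (j : Fin (n + 2)) :
    𝒰.inter A ≤ 𝒰.inter (A ∘ j.succAbove) := fun x hx =>
  (𝒰.mem_inter _ x).2 fun k => (𝒰.mem_inter A x).1 hx (j.succAbove k)

/-- The pulled back cover `{f⁻¹(U_i)}`, with the same index set. -/
def pullback (𝒰 : OpenCover Y) (f : C(X, Y)) : OpenCover X where
  ι := 𝒰.ι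
  U i := Opens.comap f (𝒰.U i)
  covers x := 𝒰.covers (f x)

/-- A refinement map exhibiting `𝒱` as a refinement of `𝒰`. -/
structure Refinement (𝒱 𝒰 : OpenCover X) where
  φ : 𝒱.ι → 𝒰.ι
  le : ∀ k, 𝒱.U k ≤ 𝒰.U (φ k)

lemma Refinement.inter_le {𝒱 𝒰 : OpenCover X} (r : Refinement 𝒱 𝒰) {n : ℕ}
    (A : Fin (n + 1) → 𝒱.ι) : 𝒱.inter A ≤ 𝒰.inter (r.φ ∘ A) := fun x hx =>
  (𝒰.mem_inter _ x).2 fun j => r.le _ ((𝒱.mem_inter A x).1 hx j)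

end OpenCover

open OpenCover

variable {X : Type u} [TopologicalSpace X] {R : Type w} [CommRing R]
  (F : (Opens X)ᵒᵖ ⥤ ModuleCat.{v} R)

/-- The restriction map `F(V) → F(U)` for `U ⊆ V`. -/
def res {U V : Opens X} (h : U ≤ V) : F.obj (op V) →ₗ[R] F.obj (op U) :=
  (F.map (homOfLE h).op).hom

lemma res_res {U V W : Opens X} (h : U ≤ V) (h' : V ≤ W) (s : F.obj (op W)) :
    res F h (res F h' s) = res F (h.trans h') s := by
  have : F.map (homOfLE (h.trans h')).op = F.map (homOfLE h').op ≫ F.map (homOfLE h).op := by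
    rw [← F.map_comp, ← op_comp, homOfLE_comp]
  simp [res, this]

/-- The Čech cochains `Cⁿ(𝒰, F) = ∏ F(U_{A 0} ∩ ⋯ ∩ U_{A n})`. -/
abbrev Cochain (𝒰 : OpenCover X) (n : ℕ) : Type (max u v) :=
  ∀ A : Fin (n + 1) → 𝒰.ι, F.obj (op (𝒰.inter A))

/-- The Čech differential. -/
def d (𝒰 : OpenCover X) (n : ℕ) : Cochain F 𝒰 n →ₗ[R] Cochain F 𝒰 (n + 1) :=
  LinearMap.pi fun A => ∑ j : Fin (n + 2),
    (-1 : R) ^ (j : ℕ) • (res F (𝒰.inter_le_face A j) ∘ₗ LinearMap.proj (A ∘ j.succAbove))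

/-- Čech cocycles. -/
abbrev cocycles (𝒰 : OpenCover X) (n : ℕ) : Submodule R (Cochain F 𝒰 n) :=
  LinearMap.ker (d F 𝒰 n)

/-- Čech coboundaries. -/
def coboundaries (𝒰 : OpenCover X) : ∀ n : ℕ, Submodule R (Cochain F 𝒰 n)
  | 0 => ⊥
  | n + 1 => LinearMap.range (d F 𝒰 n)

/-- The Čech cohomology `Hⁿ(𝒰, F)` of a cover. -/
def HCover (𝒰 : OpenCover X) (n : ℕ) : Type (max u v) :=
  (cocycles F 𝒰 n) ⧸ (coboundaries F 𝒰 n).submoduleOf (cocycles F 𝒰 n)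

instance (𝒰 : OpenCover X) (n : ℕ) : AddCommGroup (HCover F 𝒰 n) :=
  inferInstanceAs (AddCommGroup (_ ⧸ (coboundaries F 𝒰 n).submoduleOf (cocycles F 𝒰 n)))

instance (𝒰 : OpenCover X) (n : ℕ) : Module R (HCover F 𝒰 n) :=
  inferInstanceAs (Module R (_ ⧸ (coboundaries F 𝒰 n).submoduleOf (cocycles F 𝒰 n)))

/-- The class in `Hⁿ(𝒰, F)` of a cocycle. -/
def HCover.mk (𝒰 : OpenCover X) (n : ℕ) : cocycles F 𝒰 n →ₗ[R] HCover F 𝒰 n :=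
  Submodule.mkQ ((coboundaries F 𝒰 n).submoduleOf (cocycles F 𝒰 n))

/-- The map on cochains induced by a refinement map. -/
def refineCochain {𝒱 𝒰 : OpenCover X} (r : Refinement 𝒱 𝒰) (n : ℕ) :
    Cochain F 𝒰 n →ₗ[R] Cochain F 𝒱 n :=
  LinearMap.pi fun A => res F (r.inter_le A) ∘ₗ LinearMap.proj (r.φ ∘ A)

lemma d_refineCochain {𝒱 𝒰 : OpenCover X} (r : Refinement 𝒱 𝒰) (n : ℕ) (c : Cochain F 𝒰 n) :
    d F 𝒱 n (refineCochain F r n c) = refineCochain F r (n + 1) (d F 𝒰 n c) := by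
  funext A
  simp only [d, refineCochain, LinearMap.pi_apply, LinearMap.sum_apply, LinearMap.smul_apply,
    LinearMap.comp_apply, LinearMap.proj_apply, map_sum, map_smul, res_res]
  rfl

/-- The map on cocycles induced by a refinement map. -/
def refineCocycle {𝒱 𝒰 : OpenCover X} (r : Refinement 𝒱 𝒰) (n : ℕ) :
    cocycles F 𝒰 n →ₗ[R] cocycles F 𝒱 n :=
  (refineCochain F r n).restrict fun c hc => by
    rw [LinearMap.mem_ker] at hc ⊢
    rw [d_refineCochain, hc, map_zero]

lemma refineCochain_mem_coboundaries {𝒱 𝒰 : OpenCover X} (r : Refinement 𝒱 𝒰) (n : ℕ)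
    {c : Cochain F 𝒰 n} (hc : c ∈ coboundaries F 𝒰 n) :
    refineCochain F r n c ∈ coboundaries F 𝒱 n := by
  cases n with
  | zero =>
    have : c = 0 := hc
    rw [this, map_zero]
    exact Submodule.zero_mem _
  | succ n =>
    obtain ⟨b, rfl⟩ := hc
    exact ⟨refineCochain F r n b, d_refineCochain F r n b⟩

/-- The map on cohomology induced by a refinement map. -/
def refineH {𝒱 𝒰 : OpenCover X} (r : Refinement 𝒱 𝒰) (n : ℕ) :
    HCover F 𝒰 n →ₗ[R] HCover F 𝒱 n :=
  Submodule.mapQ _ _ (refineCocycle F r n) fun _ hc => refineCochain_mem_coboundaries F r n hc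

open scoped Classical in
/-- The identifications `a ∼ r^* a` in `⨁ Hⁿ(𝒰, F)`, for all refinement maps `r`. -/
def limitRelations (n : ℕ) : Submodule R (⨁ 𝒰 : OpenCover X, HCover F 𝒰 n) :=
  Submodule.span R {z | ∃ (𝒱 𝒰 : OpenCover X) (r : Refinement 𝒱 𝒰) (a : HCover F 𝒰 n),
    z = DirectSum.lof R _ (fun 𝒲 : OpenCover X => HCover F 𝒲 n) 𝒱 (refineH F r n a)
      - DirectSum.lof R _ (fun 𝒲 : OpenCover X => HCover F 𝒲 n) 𝒰 a}

/-- Čech cohomology `Ȟⁿ(X, F)`: the direct limit of `Hⁿ(𝒰, F)` over all open covers, ordered by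
refinement. (Two refinement maps between the same covers induce the same map on cohomology, so
dividing by the relations of all refinement maps gives the limit over the directed preorder.) -/
def H (n : ℕ) : Type (max (u + 1) v) :=
  (⨁ 𝒰 : OpenCover X, HCover F 𝒰 n) ⧸ limitRelations F n

instance (n : ℕ) : AddCommGroup (H F n) :=
  inferInstanceAs (AddCommGroup (_ ⧸ limitRelations F n))

instance (n : ℕ) : Module R (H F n) :=
  inferInstanceAs (Module R (_ ⧸ limitRelations F n))

/-- The canonical map `Hⁿ(𝒰, F) → Ȟⁿ(X, F)`. -/
def H.of (𝒰 : OpenCover X) (n : ℕ) : HCover F 𝒰 n →ₗ[R] H F n :=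
  open scoped Classical in
  (limitRelations F n).mkQ ∘ₗ DirectSum.lof R _ (fun 𝒲 : OpenCover X => HCover F 𝒲 n) 𝒰

/-- The class in `Ȟⁿ(X, F)` of a Čech cocycle of an open cover. -/
def cocycleClass (𝒰 : OpenCover X) (n : ℕ) : cocycles F 𝒰 n →ₗ[R] H F n :=
  H.of F 𝒰 n ∘ₗ HCover.mk F 𝒰 n

/-- The total Čech cohomology `⨁ₙ Ȟⁿ(X, F)`. -/
abbrev HTotal : Type (max (u + 1) v) := ⨁ n : ℕ, H F n

/-- The constant sheaf with stalk the multiplicative group `ℂˣ`: its sections over `U` are the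
locally constant functions `U → ℂˣ`, written additively. -/
def constUnits (X : Type u) [TopologicalSpace X] : (Opens X)ᵒᵖ ⥤ ModuleCat.{u} ℤ where
  obj U := ModuleCat.of ℤ (Additive (LocallyConstant U.unop ℂˣ))
  map {U V} i := ModuleCat.ofHom (AddMonoidHom.toIntLinearMap (MonoidHom.toAdditive
    (LocallyConstant.comapMonoidHom
      (⟨Set.inclusion i.unop.le, continuous_inclusion i.unop.le⟩ : C(V.unop, U.unop)))))
  map_id _ := rfl
  map_comp _ _ := rfl

end Cech

/-! ## Symplectic manifolds, prequantum line bundles, polarizations -/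

namespace Prequantum

universe u v

variable {E : Type*} [NormedAddCommGroup E] [NormedSpace ℝ E]
  {M : Type u} [TopologicalSpace M] [ChartedSpace E M]
  [IsManifold 𝓘(ℝ, E) ∞ M]

/-- The (possibly only locally defined) vector field `X` is smooth on `U`. -/
def SmoothField (X : ∀ x : M, TangentSpace 𝓘(ℝ, E) x) (U : Opens M) : Prop :=
  ContMDiffOn 𝓘(ℝ, E) (𝓘(ℝ, E).prod 𝓘(ℝ, E)) ∞
    (fun x => TotalSpace.mk' E (E := (TangentSpace 𝓘(ℝ, E) : M → Type _)) x (X x)) U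

variable (E M) in
/-- A symplectic form: a smooth closed nondegenerate 2-form. -/
structure SymplecticForm where
  toFun : ∀ x : M, TangentSpace 𝓘(ℝ, E) x →L[ℝ] TangentSpace 𝓘(ℝ, E) x →L[ℝ] ℝ
  alternating : ∀ x v, toFun x v v = 0
  nondegenerate : ∀ x v, (∀ w, toFun x v w = 0) → v = 0
  smooth : ContMDiff 𝓘(ℝ, E) (𝓘(ℝ, E).prod 𝓘(ℝ, E →L[ℝ] E →L[ℝ] ℝ)) ∞
    (fun x => TotalSpace.mk' (E →L[ℝ] E →L[ℝ] ℝ)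
      (E := fun x : M => TangentSpace 𝓘(ℝ, E) x →L[ℝ] TangentSpace 𝓘(ℝ, E) x →L[ℝ] ℝ) x (toFun x))
  closed : ∀ (U : Opens M) (X Y Z : ∀ x : M, TangentSpace 𝓘(ℝ, E) x),
    SmoothField X U → SmoothField Y U → SmoothField Z U → ∀ x ∈ U,
      mvfderiv 𝓘(ℝ, E) (fun y => toFun y (Y y) (Z y)) x (X x)
        + mvfderiv 𝓘(ℝ, E) (fun y => toFun y (Z y) (X y)) x (Y x)
        + mvfderiv 𝓘(ℝ, E) (fun y => toFun y (X y) (Y y)) x (Z x)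
        - toFun x (VectorField.mlieBracket 𝓘(ℝ, E) X Y x) (Z x)
        - toFun x (VectorField.mlieBracket 𝓘(ℝ, E) Y Z x) (X x)
        - toFun x (VectorField.mlieBracket 𝓘(ℝ, E) Z X x) (Y x) = 0

/-- A diffeomorphism `Φ` is a symplectomorphism of `(M, Ω)` if `Φ^* Ω = Ω`. -/
def IsSymplectomorphism (Ω : SymplecticForm E M) (Φ : M ≃ₘ⟮𝓘(ℝ, E), 𝓘(ℝ, E)⟯ M) : Prop :=
  ∀ (x : M) (v w : TangentSpace 𝓘(ℝ, E) x),
    Ω.toFun (Φ x) (mfderiv 𝓘(ℝ, E) 𝓘(ℝ, E) Φ x v) (mfderiv 𝓘(ℝ, E) 𝓘(ℝ, E) Φ x w)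
      = Ω.toFun x v w

/-- `X ∈ 𝔉_P(U)`: the vector field `X` is smooth on `U` and tangent to `P` there. -/
def IsFieldIn (P : ∀ x : M, Submodule ℝ (TangentSpace 𝓘(ℝ, E) x)) (U : Opens M)
    (X : ∀ x : M, TangentSpace 𝓘(ℝ, E) x) : Prop :=
  SmoothField X U ∧ ∀ x ∈ U, X x ∈ P x

/-- A singular real polarization of `(M, Ω)`. -/
structure IsPolarization (Ω : SymplecticForm E M)
    (P : ∀ x : M, Submodule ℝ (TangentSpace 𝓘(ℝ, E) x)) : Prop where
  /-- smooth singular subbundle: `P` is spanned by its local smooth sections -/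
  smooth : ∀ (x : M), ∀ v ∈ P x, ∃ U : Opens M, x ∈ U ∧ ∃ X, IsFieldIn P U X ∧ X x = v
  involutive : ∀ (U : Opens M) X Y, IsFieldIn P U X → IsFieldIn P U Y →
    IsFieldIn P U (VectorField.mlieBracket 𝓘(ℝ, E) X Y)
  locally_finitely_generated : ∀ x : M, ∃ U : Opens M, x ∈ U ∧
    ∃ (k : ℕ) (X : Fin k → ∀ x : M, TangentSpace 𝓘(ℝ, E) x),
      (∀ i, IsFieldIn P U (X i)) ∧
      ∀ Y, IsFieldIn P U Y → ∃ f : Fin k → M → ℝ,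
        (∀ i, ContMDiffOn 𝓘(ℝ, E) 𝓘(ℝ, ℝ) ∞ (f i) U) ∧
        ∀ y ∈ U, Y y = ∑ i, f i y • X i y
  /-- on a dense open set, `P x` is its own `Ω`-orthogonal complement -/
  generically_lagrangian : ∃ U : Opens M, Dense (U : Set M) ∧
    ∀ x ∈ U, ∀ v, v ∈ P x ↔ ∀ w ∈ P x, Ω.toFun x v w = 0

/-- `Φ(P)_x = Φ⁻¹_*(P_{Φ(x)})`. -/
def pullbackPolarization (Φ : M ≃ₘ⟮𝓘(ℝ, E), 𝓘(ℝ, E)⟯ M)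
    (P : ∀ x : M, Submodule ℝ (TangentSpace 𝓘(ℝ, E) x)) (x : M) :
    Submodule ℝ (TangentSpace 𝓘(ℝ, E) x) :=
  (P (Φ x)).comap (mfderiv 𝓘(ℝ, E) 𝓘(ℝ, E) Φ x).toLinearMap

section LineBundle

variable {L : M → Type v} [TopologicalSpace (TotalSpace ℂ L)]
  [∀ x, AddCommGroup (L x)] [∀ x, Module ℂ (L x)] [∀ x, TopologicalSpace (L x)]
  [∀ x, IsTopologicalAddGroup (L x)] [∀ x, ContinuousSMul ℝ (L x)]
  [FiberBundle ℂ L]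

variable (E) in
/-- The (possibly only locally defined) section `σ` of `L` is smooth on `U`. -/
def SmoothSection (σ : ∀ x : M, L x) (U : Opens M) : Prop :=
  ContMDiffOn 𝓘(ℝ, E) (𝓘(ℝ, E).prod 𝓘(ℝ, ℂ)) ∞ (fun x => TotalSpace.mk' ℂ x (σ x)) U

variable (L) in
/-- The structure of a prequantum line bundle on the smooth complex line bundle `L → (M, Ω)`:
a Hermitian metric and a compatible complex connection `∇` with curvature `Ω`, that is
`[∇_X, ∇_Y] - ∇_{[X, Y]} = i Ω(X, Y)`. Here `conn σ x v` is `(∇_v σ)(x)`. -/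
structure PrequantumStructure [VectorBundle ℝ ℂ L] (Ω : SymplecticForm E M) where
  conn : CovariantDerivative 𝓘(ℝ, E) ℂ L
  conn_smooth : ∀ U : Opens M, ContMDiffCovariantDerivativeOn (I := 𝓘(ℝ, E)) ℂ ∞ conn U
  conn_I_smul : ∀ (U : Opens M) (σ : ∀ x : M, L x), SmoothSection E σ U → ∀ x ∈ U, ∀ v,
    conn (fun y => Complex.I • σ y) x v = Complex.I • conn σ x v
  /-- the Hermitian metric, conjugate-linear in the first argument -/
  metric : ∀ x : M, L x →ₗ⋆[ℂ] L x →ₗ[ℂ] ℂ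
  metric_symm : ∀ x v w, metric x w v = starRingEnd ℂ (metric x v w)
  metric_pos : ∀ x v, v ≠ 0 → 0 < (metric x v v).re
  metric_smooth : ∀ (U : Opens M) (σ τ : ∀ x : M, L x), SmoothSection E σ U →
    SmoothSection E τ U →
    ContMDiffOn 𝓘(ℝ, E) 𝓘(ℝ, ℂ) ∞ (fun x => metric x (σ x) (τ x)) U
  metric_compatible : ∀ (U : Opens M) (σ τ : ∀ x : M, L x), SmoothSection E σ U →
    SmoothSection E τ U → ∀ x ∈ U, ∀ v,
      mvfderiv 𝓘(ℝ, E) (fun y => metric y (σ y) (τ y)) x v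
        = metric x (conn σ x v) (τ x) + metric x (σ x) (conn τ x v)
  curvature : ∀ (U : Opens M) (X Y : ∀ x : M, TangentSpace 𝓘(ℝ, E) x) (σ : ∀ x : M, L x),
    SmoothField X U → SmoothField Y U → SmoothSection E σ U → ∀ x ∈ U,
      conn (fun y => conn σ y (Y y)) x (X x) - conn (fun y => conn σ y (X y)) x (Y x)
        - conn σ x (VectorField.mlieBracket 𝓘(ℝ, E) X Y x)
      = (Complex.I * (Ω.toFun x (X x) (Y x) : ℂ)) • σ x

/-! ### The sheaf of polarized sections -/

open scoped Classical in
/-- Extension by zero of a section over `U` (only its values on `U` are ever used). -/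
def extendZero {U : Opens M} (s : ∀ x : U, L x) (x : M) : L x :=
  if h : x ∈ U then s ⟨x, h⟩ else 0

lemma extendZero_of_mem {U : Opens M} (s : ∀ x : U, L x) {x : M} (h : x ∈ U) :
    extendZero s x = s ⟨x, h⟩ := dif_pos h

lemma extendZero_add {U : Opens M} (s t : ∀ x : U, L x) :
    extendZero (s + t) = extendZero s + extendZero t := by
  funext x
  by_cases h : x ∈ U <;> simp [extendZero, h]

lemma extendZero_smul {U : Opens M} (z : ℂ) (s : ∀ x : U, L x) :
    extendZero (z • s) = fun x => z • extendZero s x := by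
  funext x
  by_cases h : x ∈ U <;> simp [extendZero, h]

lemma SmoothSection.mdifferentiableAt {σ : ∀ x : M, L x} {U : Opens M}
    (h : SmoothSection E σ U) {x : M} (hx : x ∈ U) :
    MDifferentiableAt 𝓘(ℝ, E) (𝓘(ℝ, E).prod 𝓘(ℝ, ℂ)) (fun x => TotalSpace.mk' ℂ x (σ x)) x :=
  ((h x hx).contMDiffAt (U.isOpen.mem_nhds hx)).mdifferentiableAt (by simp)

lemma SmoothSection.congr {σ τ : ∀ x : M, L x} {U : Opens M}
    (h : SmoothSection E σ U) (hστ : ∀ x ∈ U, τ x = σ x) : SmoothSection E τ U :=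
  ContMDiffOn.congr h fun x hx => by rw [hστ x hx]

variable [VectorBundle ℝ ℂ L] [VectorBundle ℂ ℂ L]

lemma SmoothSection.add {σ τ : ∀ x : M, L x} {U : Opens M}
    (hσ : SmoothSection E σ U) (hτ : SmoothSection E τ U) : SmoothSection E (σ + τ) U :=
  ContMDiffOn.add_section hσ hτ

lemma SmoothSection.const_smul {σ : ∀ x : M, L x} {U : Opens M} (z : ℂ)
    (hσ : SmoothSection E σ U) : SmoothSection E (fun x => z • σ x) U := by
  intro x₀ hx₀
  have h := contMDiffWithinAt_section.1 (hσ x₀ hx₀)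
  refine contMDiffWithinAt_section.2 ?_
  have h' : ContMDiffWithinAt 𝓘(ℝ, E) 𝓘(ℝ, ℂ) ∞
      (fun x => z * (trivializationAt ℂ L x₀ ⟨x, σ x⟩).2) (U : Set M) x₀ :=
    (z • ContinuousLinearMap.id ℝ ℂ).contDiff.comp_contMDiffWithinAt h
  refine h'.congr_of_eventuallyEq ?_ ?_
  · filter_upwards [mem_nhdsWithin_of_mem_nhds ((trivializationAt ℂ L x₀).open_baseSet.mem_nhds
      (mem_baseSet_trivializationAt ℂ L x₀))] with y hy
    exact ((trivializationAt ℂ L x₀).linear ℂ hy).map_smul z (σ y)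
  · exact ((trivializationAt ℂ L x₀).linear ℂ
      (mem_baseSet_trivializationAt ℂ L x₀)).map_smul z (σ x₀)

variable {Ω : SymplecticForm E M}

lemma conn_const_smul (Q : PrequantumStructure L Ω) {σ : ∀ x : M, L x} {U : Opens M} (z : ℂ)
    (hσ : SmoothSection E σ U) {x : M} (hx : x ∈ U) (v : TangentSpace 𝓘(ℝ, E) x) :
    Q.conn (fun y => z • σ y) x v = z • Q.conn σ x v := by
  have hI := hσ.const_smul Complex.I
  have h1 := Q.conn.isCovariantDerivativeOnUniv.smul_const z.re (hσ.mdifferentiableAt hx)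
  have h2 := Q.conn.isCovariantDerivativeOnUniv.smul_const z.im (hI.mdifferentiableAt hx)
  have e : (fun y => z • σ y) = z.re • σ + z.im • fun y => Complex.I • σ y := by
    funext y
    simp only [Pi.add_apply, Pi.smul_apply, ← Complex.coe_smul z.re, ← Complex.coe_smul z.im,
      smul_smul, ← add_smul, Complex.re_add_im]
  have m1 : SmoothSection E (z.re • σ) U :=
    (hσ.const_smul (z.re : ℂ)).congr fun y _ => (Complex.coe_smul z.re (σ y)).symm
  have m2 : SmoothSection E (z.im • fun y => Complex.I • σ y) U :=
    (hI.const_smul (z.im : ℂ)).congr fun y _ => (Complex.coe_smul z.im (Complex.I • σ y)).symm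
  rw [e, Q.conn.isCovariantDerivativeOnUniv.add (m1.mdifferentiableAt hx)
    (m2.mdifferentiableAt hx), h1, h2]
  simp only [add_apply, smul_apply,
    Q.conn_I_smul U σ hσ x hx]
  conv_rhs => rw [← Complex.re_add_im z, add_smul, mul_smul, Complex.coe_smul, Complex.coe_smul]

/-- `𝒮_P(U) = {s ∈ Γ(U, L) | ∇_X s = 0 for all X ∈ 𝔉_P(U)}`. -/
def polarizedSections (Q : PrequantumStructure L Ω)
    (P : ∀ x : M, Submodule ℝ (TangentSpace 𝓘(ℝ, E) x)) (U : Opens M) :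
    Submodule ℂ (∀ x : U, L x) where
  carrier := {s | SmoothSection E (extendZero s) U ∧
    ∀ X, IsFieldIn P U X → ∀ x ∈ U, Q.conn (extendZero s) x (X x) = 0}
  zero_mem' := by
    have h0 : extendZero (0 : ∀ x : U, L x) = 0 := by
      funext x
      by_cases h : x ∈ U <;> simp [extendZero, h]
    refine ⟨?_, fun X _ x _ => ?_⟩
    · rw [h0]
      exact (contMDiff_zeroSection ℝ L).contMDiffOn
    · rw [h0, Q.conn.zero]
      rfl
  add_mem' := by
    rintro s t ⟨hs, hs'⟩ ⟨ht, ht'⟩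
    refine ⟨by rw [extendZero_add]; exact hs.add ht, fun X hX x hx => ?_⟩
    rw [extendZero_add, Q.conn.isCovariantDerivativeOnUniv.add (hs.mdifferentiableAt hx)
      (ht.mdifferentiableAt hx), add_apply, hs' X hX x hx, ht' X hX x hx,
      add_zero]
  smul_mem' := by
    rintro z s ⟨hs, hs'⟩
    refine ⟨by rw [extendZero_smul]; exact hs.const_smul z, fun X hX x hx => ?_⟩
    rw [extendZero_smul, conn_const_smul Q z hs hx, hs' X hX x hx, smul_zero]

lemma exists_field_extension [FiniteDimensional ℝ E] [T2Space M]
    (P : ∀ x : M, Submodule ℝ (TangentSpace 𝓘(ℝ, E) x)) {V : Opens M} (U : Opens M)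
    (X : ∀ x : M, TangentSpace 𝓘(ℝ, E) x) (hX : IsFieldIn P V X) {x : M} (hx : x ∈ V) :
    ∃ Y, IsFieldIn P U Y ∧ Y x = X x := by
  obtain ⟨f, -, hf⟩ := ((SmoothBumpFunction.nhds_basis_tsupport (I := 𝓘(ℝ, E)) x).mem_iff).1
    (V.isOpen.mem_nhds hx)
  refine ⟨fun y => f y • X y, ⟨?_, fun y _ => ?_⟩, by simp⟩
  · have : ContMDiff 𝓘(ℝ, E) (𝓘(ℝ, E).prod 𝓘(ℝ, E)) ∞
        (fun y => TotalSpace.mk' E (E := (TangentSpace 𝓘(ℝ, E) : M → Type _)) y (f y • X y)) :=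
      ContMDiffOn.smul_section_of_tsupport (u := (V : Set M)) f.contMDiff.contMDiffOn
        V.isOpen hf hX.1
    exact this.contMDiffOn
  · by_cases hy : y ∈ V
    · exact (P y).smul_mem _ (hX.2 y hy)
    · have : f y = 0 := by
        by_contra h
        exact hy (hf (subset_tsupport f h))
      simp [this]

/-- Restriction of polarized sections to a smaller open set. -/
lemma restrict_mem [FiniteDimensional ℝ E] [T2Space M] (Q : PrequantumStructure L Ω)
    (P : ∀ x : M, Submodule ℝ (TangentSpace 𝓘(ℝ, E) x)) {V U : Opens M} (h : V ≤ U)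
    {s : ∀ x : U, L x} (hs : s ∈ polarizedSections Q P U) :
    (fun x : V => s ⟨x, h x.2⟩) ∈ polarizedSections Q P V := by
  have e : ∀ y ∈ V, extendZero (fun x : V => s ⟨x, h x.2⟩) y = extendZero s y := fun y hy => by
    rw [extendZero_of_mem _ hy, extendZero_of_mem _ (h hy)]
  have hsm : SmoothSection E (extendZero s) V := ContMDiffOn.mono hs.1 h
  have hsm' : SmoothSection E (extendZero fun x : V => s ⟨x, h x.2⟩) V := hsm.congr e
  refine ⟨hsm', fun X hX x hx => ?_⟩
  obtain ⟨Y, hY, hYX⟩ := exists_field_extension P U X hX hx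
  rw [← hYX, Q.conn.isCovariantDerivativeOnUniv.congr_of_eventuallyEq
    (hsm'.mdifferentiableAt hx) (hsm.mdifferentiableAt hx) Filter.univ_mem
    (Filter.mem_of_superset (V.isOpen.mem_nhds hx) e)]
  exact hs.2 Y hY x (h hx)

/-- The sheaf `𝒮_P` of polarized sections of `L`. -/
def polarizedSheaf [FiniteDimensional ℝ E] [T2Space M] (Q : PrequantumStructure L Ω)
    (P : ∀ x : M, Submodule ℝ (TangentSpace 𝓘(ℝ, E) x)) :
    (Opens M)ᵒᵖ ⥤ ModuleCat.{max u v} ℂ where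
  obj U := ModuleCat.of ℂ (polarizedSections Q P U.unop)
  map {_ V} i := ModuleCat.ofHom
    { toFun := fun s => ⟨fun x : V.unop => s.1 ⟨x, i.unop.le x.2⟩, restrict_mem Q P i.unop.le s.2⟩
      map_add' := fun _ _ => rfl
      map_smul' := fun _ _ => rfl }
  map_id _ := rfl
  map_comp _ _ := rfl

/-- The sheaf quantization `Q_shf(M, P) = ⨁ₙ Ȟⁿ(M, 𝒮_P)`. -/
abbrev SheafQuantization [FiniteDimensional ℝ E] [T2Space M] (Q : PrequantumStructure L Ω)
    (P : ∀ x : M, Submodule ℝ (TangentSpace 𝓘(ℝ, E) x)) : Type (max (u + 1) v) :=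
  Cech.HTotal (polarizedSheaf Q P)

/-! ### Trivialization covers and the map induced by a symplectomorphism -/

/-- The quotient `v / w ∈ ℂ` of two elements of a fibre of `L`, computed in a trivialization. -/
def quot {x : M} (v w : L x) : ℂ :=
  (trivializationAt ℂ L x ⟨x, v⟩).2 / (trivializationAt ℂ L x ⟨x, w⟩).2

/-- `v / w` is the unique `z` with `v = z w`. -/
lemma eq_quot_iff {x : M} (v : L x) {w : L x} (hw : w ≠ 0) (z : ℂ) :
    z = quot v w ↔ v = z • w := by
  let e := (trivializationAt ℂ L x).linearEquivAt ℂ x (mem_baseSet_trivializationAt ℂ L x)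
  have h : quot v w = e v / e w := rfl
  have hw' : e w ≠ 0 := fun h0 => hw (e.map_eq_zero_iff.1 h0)
  rw [h, eq_div_iff hw', ← e.injective.eq_iff (a := v), map_smul, smul_eq_mul]
  exact eq_comm

variable (E L) in
/-- Non-vanishing smooth local sections `s_α ∈ Γ(U_α, L)` over an open cover; the pair `(𝒰, s)` is
a trivialization cover of `L`. (Only the values of `s_α` on `U_α` matter.) -/
structure Trivializations (𝒰 : Cech.OpenCover M) where
  s : 𝒰.ι → ∀ x : M, L x
  smooth : ∀ α, SmoothSection E (s α) (𝒰.U α)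
  ne_zero : ∀ α, ∀ x ∈ 𝒰.U α, s α x ≠ 0

namespace Trivializations

variable {𝒰 : Cech.OpenCover M}

/-- The transition functions: `s_α = λ_{αβ} s_β`. -/
def transition (S : Trivializations E L 𝒰) (α β : 𝒰.ι) (x : M) : ℂ := quot (S.s α x) (S.s β x)

/-- The local primitives of `Ω`: `θ_α(v) s_α = -i ∇_v s_α`. -/
def theta (Q : PrequantumStructure L Ω) (S : Trivializations E L 𝒰) (α : 𝒰.ι) (x : M)
    (v : TangentSpace 𝓘(ℝ, E) x) : ℂ :=
  quot (-Complex.I • Q.conn (S.s α) x v) (S.s α x)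

end Trivializations

/-- A diffeomorphism as a continuous map. -/
def toCont (Φ : M ≃ₘ⟮𝓘(ℝ, E), 𝓘(ℝ, E)⟯ M) : C(M, M) := ⟨Φ, Φ.continuous⟩

/-- `(Φ^*𝒰, t)` is complementary to `(𝒰, s)`: the local data satisfy `λ' = Φ^*λ` and
`θ' = Φ^*θ`. -/
def IsComplementary (Q : PrequantumStructure L Ω) (Φ : M ≃ₘ⟮𝓘(ℝ, E), 𝓘(ℝ, E)⟯ M)
    {𝒰 : Cech.OpenCover M} (S : Trivializations E L 𝒰)
    (T : Trivializations E L (𝒰.pullback (toCont Φ))) : Prop :=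
  (∀ (α β : 𝒰.ι) (x : M), Φ x ∈ 𝒰.U α → Φ x ∈ 𝒰.U β →
    T.transition α β x = S.transition α β (Φ x)) ∧
  (∀ (α : 𝒰.ι) (x : M), Φ x ∈ 𝒰.U α → ∀ v : TangentSpace 𝓘(ℝ, E) x,
    T.theta Q α x v = S.theta Q α (Φ x) (mfderiv 𝓘(ℝ, E) 𝓘(ℝ, E) Φ x v))

/-- The section `τ` is the image `((σ / s_α) ∘ Φ) t_α` of the section `σ` under `Φ`, with respect
to `(𝒰, s)` and `(Φ^*𝒰, t)`. -/
def IsTransport (Φ : M ≃ₘ⟮𝓘(ℝ, E), 𝓘(ℝ, E)⟯ M)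
    {𝒰 : Cech.OpenCover M} (S : Trivializations E L 𝒰)
    (T : Trivializations E L (𝒰.pullback (toCont Φ)))
    {V W : Opens M} (σ : ∀ x : V, L x) (τ : ∀ x : W, L x) : Prop :=
  ∀ (α : 𝒰.ι) (x : M) (hV : Φ x ∈ V) (hW : x ∈ W), Φ x ∈ 𝒰.U α →
    τ ⟨x, hW⟩ = quot (σ ⟨Φ x, hV⟩) (S.s α (Φ x)) • T.s α x

/-- The linear isomorphism `e` of sheaf quantizations is induced by `Φ` through `(𝒰, s)` and
`(Φ^*𝒰, t)`: for every open cover `𝒱`, it sends the class of a cocycle `c ∈ Žⁿ(𝒱, 𝒮_P)` to the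
class of the cocycle in `Žⁿ(Φ^*𝒱, 𝒮_{Φ(P)})` with components `((c_A / s_α) ∘ Φ) t_α`. -/
def IsInducedBy [FiniteDimensional ℝ E] [T2Space M] (Q : PrequantumStructure L Ω)
    (P : ∀ x : M, Submodule ℝ (TangentSpace 𝓘(ℝ, E) x)) (Φ : M ≃ₘ⟮𝓘(ℝ, E), 𝓘(ℝ, E)⟯ M)
    {𝒰 : Cech.OpenCover M} (S : Trivializations E L 𝒰)
    (T : Trivializations E L (𝒰.pullback (toCont Φ)))
    (e : SheafQuantization Q P ≃ₗ[ℂ] SheafQuantization Q (pullbackPolarization Φ P)) : Prop :=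
  ∀ (n : ℕ) (𝒱 : Cech.OpenCover M) (c : Cech.cocycles (polarizedSheaf Q P) 𝒱 n),
    ∃ c' : Cech.cocycles (polarizedSheaf Q (pullbackPolarization Φ P))
        (𝒱.pullback (toCont Φ)) n,
      (∀ A : Fin (n + 1) → 𝒱.ι, IsTransport Φ S T (c.1 A).1 (c'.1 A).1) ∧
      e (DirectSum.lof ℂ ℕ (fun k => Cech.H (polarizedSheaf Q P) k) n
          (Cech.cocycleClass _ 𝒱 n c)) =
        DirectSum.lof ℂ ℕ
          (fun k => Cech.H (polarizedSheaf Q (pullbackPolarization Φ P)) k) n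
          (Cech.cocycleClass _ (𝒱.pullback (toCont Φ)) n c')

end LineBundle

end Prequantum

end

/-! Everything rests on the behaviour of a frame under Φ. If `∇s = iθ ⊗ s`, then `∇(g s) = (dg + i g
θ) s`, and `dg` and `θ` both commute with pullback. So once frames `s_α` over `U_α` and `t_α` over
`Φ⁻¹(U_α)` have local data matched by Φ, the assignment `g s_α ↦ (g ∘ Φ) t_α` does not depend on α
(equal transition functions) and intertwines `∇_v` with `∇_{Φ_* v}` (equal connection forms):
`FramePair.transport_eq` and `FramePair.transport_local`. It therefore carries `𝒮_P` to `𝒮_{Φ(P)}`,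
with inverse the same construction for `Φ⁻¹` and the frames exchanged. `Comorphism.equivH` turns
these two mutually inverse maps of presheaves over Φ and `Φ⁻¹` into an isomorphism on Čech
cohomology, given on cocycles by the stated formula.

Existence of a complementary cover is where `Ȟ¹(M, ℂˣ) = 0` enters. Locally, compare `Φ^*θ_α` with
the form `θ₀` of any frame `s₀`. The curvature identity gives `dθ = ω` for both frames, and `Φ^*ω =
ω`, so `Φ^*θ_α - θ₀` is closed, hence locally `dh`, and `exp(ih) s₀` has connection form `Φ^*θ_α`
(`exists_local_frame`). Such local frames have the right connection forms, but their transition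
functions agree with `λ ∘ Φ` only up to factors with vanishing derivative, that is, a locally
constant `ℂˣ`-valued cocycle. The vanishing of `Ȟ¹` makes it a coboundary on a refinement
(`exists_locallyConstant_trivialization`); rescaling by the cochain corrects the transition
functions without changing the connection forms, and the frames glue (`exists_isComplementary`).

That `Φ(P)` is a polarization follows from naturality of the Lie bracket under pullback and from
invariance of `ω`. -/

noncomputable section

namespace Cech

universe u v w

open OpenCover

/-! ### Functoriality of Čech cohomology for maps of presheaves over a continuous map -/

section Functoriality

variable {X Y : Type u} [TopologicalSpace X] [TopologicalSpace Y] {R : Type w} [CommRing R]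
  {F : (Opens X)ᵒᵖ ⥤ ModuleCat.{v} R} {G : (Opens Y)ᵒᵖ ⥤ ModuleCat.{v} R}

lemma d_apply {𝒰 : OpenCover X} {n : ℕ} (c : Cochain F 𝒰 n) (A : Fin (n + 2) → 𝒰.ι) :
    d F 𝒰 n c A = ∑ j : Fin (n + 2),
      (-1 : R) ^ (j : ℕ) • res F (𝒰.inter_le_face A j) (c (A ∘ j.succAbove)) := by
  simp [d]

lemma cocycleClass_refineCocycle {𝒱 𝒰 : OpenCover X} (r : Refinement 𝒱 𝒰) (n : ℕ)
    (c : cocycles F 𝒰 n) :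
    cocycleClass F 𝒱 n (refineCocycle F r n c) = cocycleClass F 𝒰 n c := by
  classical
  refine (Submodule.Quotient.eq (limitRelations F n)).2 (Submodule.subset_span ?_)
  refine ⟨𝒱, 𝒰, r, HCover.mk F 𝒰 n c, rfl⟩

/-- The limit is a quotient of a direct sum of quotients of cocycle modules, so cocycle classes span
it. -/
lemma H.hom_ext {N : Type*} [AddCommGroup N] [Module R N] {n : ℕ} {f g : H F n →ₗ[R] N}
    (h : ∀ (𝒰 : OpenCover X) (c : cocycles F 𝒰 n),
      f (cocycleClass F 𝒰 n c) = g (cocycleClass F 𝒰 n c)) : f = g := by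
  classical
  refine Submodule.linearMap_qext _ (DirectSum.linearMap_ext R fun 𝒰 => ?_)
  refine Submodule.linearMap_qext _ (LinearMap.ext fun c => ?_)
  exact h 𝒰 c

variable (F) in
/-- A map of presheaves of modules over a continuous map `f`: compatible linear maps
`F(V) → G(W)` for `W ⊆ f⁻¹(V)`. -/
structure Comorphism (f : C(Y, X)) (G : (Opens Y)ᵒᵖ ⥤ ModuleCat.{v} R) where
  app : ∀ {V : Opens X} {W : Opens Y}, W ≤ Opens.comap f V →
    (F.obj (op V) →ₗ[R] G.obj (op W))
  naturality : ∀ {V V' : Opens X} {W W' : Opens Y} (h : W ≤ Opens.comap f V)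
    (h' : W' ≤ Opens.comap f V') (hV : V' ≤ V) (hW : W' ≤ W) (s : F.obj (op V)),
    res G hW (app h s) = app h' (res F hV s)

namespace Comorphism

variable {f : C(Y, X)} (T : Comorphism F f G)

lemma inter_pullback_le (𝒰 : OpenCover X) (f : C(Y, X)) {n : ℕ} (A : Fin (n + 1) → 𝒰.ι) :
    (𝒰.pullback f).inter A ≤ Opens.comap f (𝒰.inter A) := fun x hx =>
  (𝒰.mem_inter A (f x)).2 (((𝒰.pullback f).mem_inter A x).1 hx)

/-- The map on Čech cochains induced by a comorphism. -/
def mapCochain (𝒰 : OpenCover X) (n : ℕ) :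
    Cochain F 𝒰 n →ₗ[R] Cochain G (𝒰.pullback f) n :=
  LinearMap.pi fun A => T.app (inter_pullback_le 𝒰 f A) ∘ₗ LinearMap.proj A

lemma d_mapCochain (𝒰 : OpenCover X) (n : ℕ) (c : Cochain F 𝒰 n) :
    d G (𝒰.pullback f) n (T.mapCochain 𝒰 n c) = T.mapCochain 𝒰 (n + 1) (d F 𝒰 n c) := by
  funext A
  rw [d_apply]
  refine Eq.trans ?_ ((congrArg (T.app (inter_pullback_le 𝒰 f (n := n + 1) A))
    (d_apply c (𝒰 := 𝒰) A)).trans (map_sum _ _ _)).symm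
  refine Finset.sum_congr rfl fun j _ => ?_
  rw [map_smul]
  exact congrArg _ (T.naturality _ _ _ _ _)

/-- The map on Čech cocycles induced by a comorphism. -/
def mapCocycle (𝒰 : OpenCover X) (n : ℕ) :
    cocycles F 𝒰 n →ₗ[R] cocycles G (𝒰.pullback f) n :=
  (T.mapCochain 𝒰 n).restrict fun c hc => by
    rw [LinearMap.mem_ker] at hc ⊢
    rw [d_mapCochain, hc, map_zero]

lemma mapCochain_mem_coboundaries (𝒰 : OpenCover X) (n : ℕ) {c : Cochain F 𝒰 n}
    (hc : c ∈ coboundaries F 𝒰 n) :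
    T.mapCochain 𝒰 n c ∈ coboundaries G (𝒰.pullback f) n := by
  cases n with
  | zero =>
    have : c = 0 := hc
    rw [this, map_zero]
    exact Submodule.zero_mem _
  | succ n =>
    obtain ⟨b, rfl⟩ := hc
    exact ⟨T.mapCochain 𝒰 n b, T.d_mapCochain 𝒰 n b⟩

/-- The map on the cohomology of a cover induced by a comorphism. -/
def mapHCover (𝒰 : OpenCover X) (n : ℕ) :
    HCover F 𝒰 n →ₗ[R] HCover G (𝒰.pullback f) n :=
  Submodule.mapQ _ _ (T.mapCocycle 𝒰 n) fun _ hc => T.mapCochain_mem_coboundaries 𝒰 n hc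

/-- Pulling back a refinement map. -/
def pullbackRefinement (f : C(Y, X)) {𝒱 𝒰 : OpenCover X} (r : Refinement 𝒱 𝒰) :
    Refinement (𝒱.pullback f) (𝒰.pullback f) where
  φ := r.φ
  le k := fun x hx => r.le k (show f x ∈ 𝒱.U k from hx)

lemma mapHCover_refineH {𝒱 𝒰 : OpenCover X} (r : Refinement 𝒱 𝒰) (n : ℕ) (a : HCover F 𝒰 n) :
    T.mapHCover 𝒱 n (refineH F r n a)
      = refineH G (pullbackRefinement f r) n (T.mapHCover 𝒰 n a) := by
  obtain ⟨c, rfl⟩ := Submodule.Quotient.mk_surjective _ a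
  refine congrArg (HCover.mk G (𝒱.pullback f) n) (Subtype.ext (funext fun A => ?_))
  exact (T.naturality _ _ _ _ _).symm

open scoped Classical in
/-- The map on Čech cohomology induced by a comorphism. -/
def mapH (n : ℕ) : H F n →ₗ[R] H G n :=
  (limitRelations F n).liftQ
    (DirectSum.toModule R _ _ fun 𝒰 => H.of G (𝒰.pullback f) n ∘ₗ T.mapHCover 𝒰 n) <| by
    refine Submodule.span_le.2 ?_
    rintro _ ⟨𝒱, 𝒰, r, a, rfl⟩
    rw [SetLike.mem_coe, LinearMap.mem_ker, map_sub, DirectSum.toModule_lof,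
      DirectSum.toModule_lof, LinearMap.comp_apply, LinearMap.comp_apply, mapHCover_refineH,
      sub_eq_zero]
    refine (Submodule.Quotient.eq (limitRelations G n)).2 (Submodule.subset_span ?_)
    exact ⟨_, _, pullbackRefinement f r, T.mapHCover 𝒰 n a, rfl⟩

lemma mapH_cocycleClass (𝒰 : OpenCover X) (n : ℕ) (c : cocycles F 𝒰 n) :
    T.mapH n (cocycleClass F 𝒰 n c) = cocycleClass G (𝒰.pullback f) n (T.mapCocycle 𝒰 n c) := by
  classical
  refine (Submodule.liftQ_apply _ _ _).trans ?_
  refine (DirectSum.toModule_lof R _ _).trans ?_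
  rfl

/-- Pulling a cover back along `f` and then along `g` does not literally return the cover, but the
result refines it through the identity on indices. The composite is this refinement on cocycles,
which becomes the identity in the limit. -/
lemma mapH_comp_mapH {g : C(X, Y)} (S : Comorphism G g F) (hfg : ∀ x, f (g x) = x)
    (hST : ∀ {V : Opens X} {W : Opens Y} {V' : Opens X} (h : W ≤ Opens.comap f V)
      (h' : V' ≤ Opens.comap g W) (hV : V' ≤ V) (s : F.obj (op V)),
      S.app h' (T.app h s) = res F hV s) (n : ℕ) :
    S.mapH n ∘ₗ T.mapH n = LinearMap.id := by
  refine H.hom_ext fun 𝒰 c => ?_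
  rw [LinearMap.comp_apply, mapH_cocycleClass, mapH_cocycleClass, LinearMap.id_apply]
  let r : Refinement ((𝒰.pullback f).pullback g) 𝒰 :=
    { φ := id
      le := fun k x hx => by
        have : f (g x) ∈ 𝒰.U k := hx
        rwa [hfg] at this }
  rw [← cocycleClass_refineCocycle r n c]
  congr 1
  exact Subtype.ext (funext fun A => hST _ _ _ _)

/-- Mutually inverse comorphisms induce an isomorphism on Čech cohomology. -/
def equivH {g : C(X, Y)} (S : Comorphism G g F) (hfg : ∀ x, f (g x) = x) (hgf : ∀ y, g (f y) = y)
    (hST : ∀ {V : Opens X} {W : Opens Y} {V' : Opens X} (h : W ≤ Opens.comap f V)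
      (h' : V' ≤ Opens.comap g W) (hV : V' ≤ V) (s : F.obj (op V)),
      S.app h' (T.app h s) = res F hV s)
    (hTS : ∀ {W : Opens Y} {V : Opens X} {W' : Opens Y} (h : V ≤ Opens.comap g W)
      (h' : W' ≤ Opens.comap f V) (hW : W' ≤ W) (s : G.obj (op W)),
      T.app h' (S.app h s) = res G hW s) (n : ℕ) :
    H F n ≃ₗ[R] H G n :=
  LinearEquiv.ofLinearMap (T.mapH n) (S.mapH n) (S.mapH_comp_mapH T hgf hTS n)
    (T.mapH_comp_mapH S hfg hST n)

end Comorphism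

end Functoriality

/-! ### Degree one: a class that dies in the limit dies on some refinement -/

section DegreeOne

variable {X : Type u} [TopologicalSpace X] {R : Type w} [CommRing R]
  (F : (Opens X)ᵒᵖ ⥤ ModuleCat.{v} R)

/-- A common refinement of two open covers. -/
def OpenCover.inf (𝒰 𝒱 : OpenCover X) : OpenCover X where
  ι := 𝒰.ι × 𝒱.ι
  U k := 𝒰.U k.1 ⊓ 𝒱.U k.2
  covers x := by
    obtain ⟨i, hi⟩ := 𝒰.covers x
    obtain ⟨j, hj⟩ := 𝒱.covers x
    exact ⟨(i, j), hi, hj⟩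

/-- The refinement of the first cover by the common refinement. -/
def OpenCover.infLeft (𝒰 𝒱 : OpenCover X) : Refinement (𝒰.inf 𝒱) 𝒰 := ⟨Prod.fst, fun _ _ h => h.1⟩

/-- The refinement of the second cover by the common refinement. -/
def OpenCover.infRight (𝒰 𝒱 : OpenCover X) : Refinement (𝒰.inf 𝒱) 𝒱 := ⟨Prod.snd, fun _ _ h => h.2⟩

/-- The composition of refinement maps. -/
def OpenCover.Refinement.trans {𝒲 𝒱 𝒰 : OpenCover X} (s : Refinement 𝒲 𝒱) (r : Refinement 𝒱 𝒰) :
    Refinement 𝒲 𝒰 := ⟨r.φ ∘ s.φ, fun k => (s.le k).trans (r.le _)⟩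

lemma refineH_trans {𝒲 𝒱 𝒰 : OpenCover X} (s : Refinement 𝒲 𝒱) (r : Refinement 𝒱 𝒰) (n : ℕ)
    (a : HCover F 𝒰 n) : refineH F s n (refineH F r n a) = refineH F (s.trans r) n a := by
  obtain ⟨c, rfl⟩ := Submodule.Quotient.mk_surjective _ a
  exact congrArg (HCover.mk F 𝒲 n) (Subtype.ext (funext fun A => res_res F _ _ _))

lemma d_one_apply {𝒰 : OpenCover X} (c : Cochain F 𝒰 1) (A : Fin 3 → 𝒰.ι) :
    d F 𝒰 1 c A = res F (𝒰.inter_le_face A 0) (c (A ∘ (0 : Fin 3).succAbove))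
      - res F (𝒰.inter_le_face A 1) (c (A ∘ (1 : Fin 3).succAbove))
      + res F (𝒰.inter_le_face A 2) (c (A ∘ (2 : Fin 3).succAbove)) := by
  refine (d_apply c A).trans ((Fin.sum_univ_three _).trans ?_)
  simp [sub_eq_add_neg]

lemma d_zero_apply {𝒰 : OpenCover X} (c : Cochain F 𝒰 0) (A : Fin 2 → 𝒰.ι) :
    d F 𝒰 0 c A = res F (𝒰.inter_le_face A 0) (c (A ∘ (0 : Fin 2).succAbove))
      - res F (𝒰.inter_le_face A 1) (c (A ∘ (1 : Fin 2).succAbove)) := by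
  refine (d_apply c A).trans ((Fin.sum_univ_two _).trans ?_)
  simp [sub_eq_add_neg]

lemma res_congr {𝒰 : OpenCover X} {n : ℕ} (c : Cochain F 𝒰 n) {A B : Fin (n + 1) → 𝒰.ι}
    (h : A = B) {W : Opens X} (hA : W ≤ 𝒰.inter A) (hB : W ≤ 𝒰.inter B) :
    res F hA (c A) = res F hB (c B) := by
  subst h
  rfl

/-- Two refinement maps between the same covers agree on `H¹`. -/
lemma refineH_one_eq {𝒱 𝒰 : OpenCover X} (r r' : Refinement 𝒱 𝒰) (a : HCover F 𝒰 1) :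
    refineH F r 1 a = refineH F r' 1 a := by
  obtain ⟨c, rfl⟩ := Submodule.Quotient.mk_surjective _ a
  refine (Submodule.Quotient.eq _).2 ?_
  have hle : ∀ A : Fin 1 → 𝒱.ι, 𝒱.inter A ≤ 𝒰.inter ![r'.φ (A 0), r.φ (A 0)] := by
    intro A x hx
    have h0 := (𝒱.mem_inter A x).1 hx 0
    refine (𝒰.mem_inter _ x).2 fun j => ?_
    fin_cases j
    exacts [r'.le _ h0, r.le _ h0]
  -- The chain homotopy between the two refinement maps: `k ↦ c(r' k, r k)`.
  refine ⟨fun A => res F (hle A) (c.1 _), funext fun A => ?_⟩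
  have key : ∀ p q s : 𝒰.ι, ∀ (h1 : 𝒱.inter A ≤ 𝒰.inter ![q, s])
      (h2 : 𝒱.inter A ≤ 𝒰.inter ![p, s]) (h3 : 𝒱.inter A ≤ 𝒰.inter ![p, q]),
      res F h1 (c.1 _) - res F h2 (c.1 _) + res F h3 (c.1 _) = 0 := by
    intro p q s h1 h2 h3
    have hc := congrFun (LinearMap.mem_ker.1 c.2) ![p, q, s]
    rw [d_one_apply] at hc
    have hW : 𝒱.inter A ≤ 𝒰.inter ![p, q, s] := by
      intro x hx
      refine (𝒰.mem_inter _ x).2 fun j => ?_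
      fin_cases j
      exacts [(𝒰.mem_inter _ x).1 (h2 hx) 0, (𝒰.mem_inter _ x).1 (h1 hx) 0,
        (𝒰.mem_inter _ x).1 (h1 hx) 1]
    have hc' := congrArg (res F hW) hc
    simp only [map_add, map_sub, res_res] at hc'
    rw [Pi.zero_apply, map_zero] at hc'
    rw [← hc']
    have e : ∀ {B : Fin 2 → 𝒰.ι} {B' : Fin 2 → 𝒰.ι} (h : 𝒱.inter A ≤ 𝒰.inter B)
        (h' : 𝒱.inter A ≤ 𝒰.inter B'), B 0 = B' 0 → B 1 = B' 1 →
        res F h (c.1 B) = res F h' (c.1 B') := fun h h' h0 h1 =>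
      res_congr F c.1 (funext (Fin.forall_fin_two.2 ⟨h0, h1⟩)) h h'
    exact congrArg₂ _ (congrArg₂ _ (e _ _ rfl rfl) (e _ _ rfl rfl)) (e _ _ rfl rfl)
  have mem : ∀ x ∈ 𝒱.inter A, ∀ i j : Fin 2, ∀ r₁ r₂ : Refinement 𝒱 𝒰,
      x ∈ 𝒰.inter ![r₁.φ (A i), r₂.φ (A j)] := by
    intro x hx i j r₁ r₂
    refine (𝒰.mem_inter _ x).2 fun k => ?_
    fin_cases k
    exacts [r₁.le _ ((𝒱.mem_inter A x).1 hx i), r₂.le _ ((𝒱.mem_inter A x).1 hx j)]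
  -- With `A = (k, l)`, these are the cocycle identities on the triples `(r' k, r' l, r l)` and `(r'
  -- k, r k, r l)`. They share the term `c(r' k, r l)`, and their difference is the homotopy
  -- formula.
  have k1 := key (r'.φ (A 0)) (r'.φ (A 1)) (r.φ (A 1)) (fun x hx => mem x hx 1 1 r' r)
    (fun x hx => mem x hx 0 1 r' r) (fun x hx => mem x hx 0 1 r' r')
  have k2 := key (r'.φ (A 0)) (r.φ (A 0)) (r.φ (A 1)) (fun x hx => mem x hx 0 1 r r)
    (fun x hx => mem x hx 0 1 r' r) (fun x hx => mem x hx 0 0 r' r)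
  have e : ∀ r₁ : Refinement 𝒱 𝒰, ∀ h : 𝒱.inter A ≤ 𝒰.inter ![r₁.φ (A 0), r₁.φ (A 1)],
      res F h (c.1 _) = refineCochain F r₁ 1 c.1 A := fun r₁ h => by
    refine res_congr F c.1 (funext fun j => ?_) _ _
    fin_cases j <;> rfl
  rw [e] at k1 k2
  rw [d_zero_apply, res_res, res_res]
  change _ = refineCochain F r 1 c.1 A - refineCochain F r' 1 c.1 A
  rw [sub_eq_sub_iff_add_eq_add]
  have k3 := sub_eq_zero.2 (k1.trans k2.symm)
  rw [← sub_eq_zero, ← k3]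
  change res F _ (c.1 ![r'.φ (A 1), r.φ (A 1)]) + _
    - (_ + res F _ (c.1 ![r'.φ (A 0), r.φ (A 0)])) = _
  abel

/-- The canonical map `H¹(𝒰, F) → Ȟ¹(X, F)` only kills classes that vanish on a refinement. -/
lemma exists_refinement_of_H_of_eq_zero {𝒰 : OpenCover X} {a : HCover F 𝒰 1}
    (ha : H.of F 𝒰 1 a = 0) : ∃ (𝒱 : OpenCover X) (r : Refinement 𝒱 𝒰), refineH F r 1 a = 0 := by
  classical
  -- Restriction to `𝒲` along an arbitrarily chosen refinement map, which is legitimate because the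
  -- choice is invisible on `H¹`. The value 0 when `𝒲` does not refine `𝒰` is harmless, since the
  -- relations are only tested on covers `𝒲` refining both covers involved.
  let ρ (𝒲 𝒰 : OpenCover X) : HCover F 𝒰 1 →ₗ[R] HCover F 𝒲 1 :=
    if h : Nonempty (Refinement 𝒲 𝒰) then refineH F h.some 1 else 0
  have hρ : ∀ {𝒲 𝒰 : OpenCover X} (r : Refinement 𝒲 𝒰) (a : HCover F 𝒰 1),
      ρ 𝒲 𝒰 a = refineH F r 1 a := fun {𝒲 𝒰} r a => by
    have h : Nonempty (Refinement 𝒲 𝒰) := ⟨r⟩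
    simp only [ρ, dif_pos h]
    exact refineH_one_eq F _ _ _
  -- The elements whose components, restricted to `𝒲` and added up, cancel for every sufficiently
  -- fine `𝒲`. This plays the role of the kernel of the map to the directed limit and contains all
  -- defining relations.
  let N : Submodule R (⨁ 𝒰 : OpenCover X, HCover F 𝒰 1) :=
    { carrier := {z | ∃ 𝒱 : OpenCover X, ∀ 𝒲, Nonempty (Refinement 𝒲 𝒱) →
        DirectSum.toModule R _ _ (ρ 𝒲) z = 0}
      zero_mem' := ⟨𝒰, fun 𝒲 _ => map_zero _⟩
      add_mem' := by
        rintro y z ⟨𝒱, hy⟩ ⟨𝒱', hz⟩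
        refine ⟨𝒱.inf 𝒱', fun 𝒲 ⟨r⟩ => ?_⟩
        rw [map_add, hy 𝒲 ⟨r.trans (𝒱.infLeft 𝒱')⟩, hz 𝒲 ⟨r.trans (𝒱.infRight 𝒱')⟩, add_zero]
      smul_mem' := by
        rintro k z ⟨𝒱, hz⟩
        exact ⟨𝒱, fun 𝒲 h => by rw [map_smul, hz 𝒲 h, smul_zero]⟩ }
  have hN : limitRelations F 1 ≤ N := by
    refine Submodule.span_le.2 ?_
    rintro _ ⟨𝒱, 𝒰, r, a, rfl⟩
    refine ⟨𝒱, fun 𝒲 ⟨s⟩ => ?_⟩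
    rw [map_sub, DirectSum.toModule_lof, DirectSum.toModule_lof, hρ s, hρ (s.trans r),
      refineH_trans, sub_self]
  have hmem : DirectSum.lof R _ (fun 𝒲 : OpenCover X => HCover F 𝒲 1) 𝒰 a
      ∈ limitRelations F 1 := by
    exact (Submodule.Quotient.mk_eq_zero _).1 ha
  obtain ⟨𝒱, h𝒱⟩ := hN hmem
  -- The cover `𝒱` obtained from `N` need not refine `𝒰`, so the two are intersected.
  refine ⟨𝒱.inf 𝒰, 𝒱.infRight 𝒰, ?_⟩
  have := h𝒱 (𝒱.inf 𝒰) ⟨𝒱.infLeft 𝒰⟩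
  rwa [DirectSum.toModule_lof, hρ (𝒱.infRight 𝒰)] at this

/-- If `Ȟ¹(X, F) = 0`, every `1`-cocycle is a coboundary on a refinement. -/
lemma exists_refinement_coboundary [Subsingleton (H F 1)] {𝒰 : OpenCover X}
    (c : cocycles F 𝒰 1) : ∃ (𝒱 : OpenCover X) (r : Refinement 𝒱 𝒰) (b : Cochain F 𝒱 0),
      d F 𝒱 0 b = refineCochain F r 1 c.1 := by
  obtain ⟨𝒱, r, h⟩ := exists_refinement_of_H_of_eq_zero F
    (a := HCover.mk F 𝒰 1 c) (Subsingleton.elim _ _)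
  obtain ⟨b, hb⟩ := (Submodule.Quotient.mk_eq_zero _).1 h
  exact ⟨𝒱, r, b, hb⟩

end DegreeOne

end Cech

namespace Prequantum

universe u v

/-! ### Chain rules and products for vector-valued functions on manifolds -/

section Derivative

variable {E : Type*} [NormedAddCommGroup E] [NormedSpace ℝ E]
  {M : Type*} [TopologicalSpace M] [ChartedSpace E M]
  {E' : Type*} [NormedAddCommGroup E'] [NormedSpace ℝ E']
  {M' : Type*} [TopologicalSpace M'] [ChartedSpace E' M']
  {F : Type*} [NormedAddCommGroup F] [NormedSpace ℝ F]
  {F' : Type*} [NormedAddCommGroup F'] [NormedSpace ℝ F']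

lemma mvfderiv_comp_mfderiv {g : M' → F} {f : M → M'} {x : M}
    (hg : MDifferentiableAt 𝓘(ℝ, E') 𝓘(ℝ, F) g (f x))
    (hf : MDifferentiableAt 𝓘(ℝ, E) 𝓘(ℝ, E') f x) (v : TangentSpace 𝓘(ℝ, E) x) :
    mvfderiv 𝓘(ℝ, E) (fun y => g (f y)) x v
      = mvfderiv 𝓘(ℝ, E') g (f x) (mfderiv 𝓘(ℝ, E) 𝓘(ℝ, E') f x v) :=
  mfderiv_comp_apply x hg hf v

lemma mvfderiv_clm_comp (l : F →L[ℝ] F') {f : M → F} {x : M}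
    (hf : MDifferentiableAt 𝓘(ℝ, E) 𝓘(ℝ, F) f x) (v : TangentSpace 𝓘(ℝ, E) x) :
    mvfderiv 𝓘(ℝ, E) (fun y => l (f y)) x v = l (mvfderiv 𝓘(ℝ, E) f x v) := by
  have h := mfderiv_comp_apply x (l.hasMFDerivAt.mdifferentiableAt (x := f x)) hf v
  rw [ContinuousLinearMap.mfderiv_eq] at h
  exact h

lemma mdifferentiableAt_of_contMDiffOn {f : M → F} {U : Opens M}
    (hf : ContMDiffOn 𝓘(ℝ, E) 𝓘(ℝ, F) ∞ f U) {x : M} (hx : x ∈ U) :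
    MDifferentiableAt 𝓘(ℝ, E) 𝓘(ℝ, F) f x :=
  ((hf x hx).contMDiffAt (U.isOpen.mem_nhds hx)).mdifferentiableAt (by simp)

lemma contMDiffWithinAt_complex_mul {f g : M → ℂ} {s : Set M} {x : M}
    (hf : ContMDiffWithinAt 𝓘(ℝ, E) 𝓘(ℝ, ℂ) ∞ f s x)
    (hg : ContMDiffWithinAt 𝓘(ℝ, E) 𝓘(ℝ, ℂ) ∞ g s x) :
    ContMDiffWithinAt 𝓘(ℝ, E) 𝓘(ℝ, ℂ) ∞ (fun y => f y * g y) s x :=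
  (contDiff_mul (𝕜 := ℝ) (𝔸 := ℂ)).contMDiff.contMDiffAt.comp_contMDiffWithinAt x
    (hf.prodMk_space hg)

end Derivative

variable {E : Type*} [NormedAddCommGroup E] [NormedSpace ℝ E]
  {M : Type u} [TopologicalSpace M] [ChartedSpace E M]
  [IsManifold 𝓘(ℝ, E) ∞ M]

/-! ### Complex calculus of sections: quotients, the Leibniz rule, connection forms, curvature -/

section LineBundle

variable {L : M → Type v} [TopologicalSpace (TotalSpace ℂ L)]
  [∀ x, AddCommGroup (L x)] [∀ x, Module ℂ (L x)] [∀ x, TopologicalSpace (L x)]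
  [∀ x, IsTopologicalAddGroup (L x)] [∀ x, ContinuousSMul ℝ (L x)]
  [FiberBundle ℂ L] [VectorBundle ℝ ℂ L] [VectorBundle ℂ ℂ L]
  {Ω : SymplecticForm E M}

/-- `quot` uses the trivialization centred at the moving point `x`. Fibrewise ℂ-linearity makes the
ratio independent of the trivialization, so near `x₀` a single one suffices; this is what makes
quotients of smooth sections visibly smooth. -/
lemma quot_eq_div {x₀ x : M} (hx : x ∈ (trivializationAt ℂ L x₀).baseSet) (v : L x) {w : L x}
    (hw : w ≠ 0) :
    quot v w = (trivializationAt ℂ L x₀ ⟨x, v⟩).2 / (trivializationAt ℂ L x₀ ⟨x, w⟩).2 := by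
  let e := (trivializationAt ℂ L x₀).linearEquivAt ℂ x hx
  have hw' : e w ≠ 0 := fun h0 => hw (e.map_eq_zero_iff.1 h0)
  refine ((eq_quot_iff v hw _).2 (e.injective ?_)).symm
  rw [map_smul, smul_eq_mul]
  exact (div_mul_cancel₀ (e v) hw').symm

lemma quot_smul_self {x : M} (v : L x) {w : L x} (hw : w ≠ 0) : quot v w • w = v :=
  ((eq_quot_iff v hw _).1 rfl).symm

lemma quot_smul_right {x : M} (z : ℂ) {w : L x} (hw : w ≠ 0) : quot (z • w) w = z :=
  ((eq_quot_iff (z • w) hw z).2 rfl).symm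

lemma quot_ne_zero {x : M} {v w : L x} (hv : v ≠ 0) (hw : w ≠ 0) : quot v w ≠ 0 := fun h => by
  have := quot_smul_self v hw
  rw [h, zero_smul] at this
  exact hv this.symm

lemma smul_fiber_right_injective {x : M} {w : L x} (hw : w ≠ 0) {z z' : ℂ} (h : z • w = z' • w) :
    z = z' := by
  rw [← quot_smul_right z hw, h, quot_smul_right z' hw]

lemma contMDiffOn_quot {σ s : ∀ x : M, L x} {U : Opens M} (hσ : SmoothSection E σ U)
    (hs : SmoothSection E s U) (h0 : ∀ x ∈ U, s x ≠ 0) :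
    ContMDiffOn 𝓘(ℝ, E) 𝓘(ℝ, ℂ) ∞ (fun x => quot (σ x) (s x)) U := by
  intro x₀ hx₀
  have h1 := contMDiffWithinAt_section.1 (hσ x₀ hx₀)
  have h2 := contMDiffWithinAt_section.1 (hs x₀ hx₀)
  have hb := mem_baseSet_trivializationAt ℂ L x₀
  have hne : (trivializationAt ℂ L x₀ ⟨x₀, s x₀⟩).2 ≠ 0 := fun h =>
    h0 x₀ hx₀ (((trivializationAt ℂ L x₀).linearEquivAt ℂ x₀ hb).map_eq_zero_iff.1 h)
  have h3 : ContMDiffWithinAt 𝓘(ℝ, E) 𝓘(ℝ, ℂ) ∞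
      (fun x => (trivializationAt ℂ L x₀ ⟨x, σ x⟩).2 * ((trivializationAt ℂ L x₀ ⟨x, s x⟩).2)⁻¹)
      (U : Set M) x₀ :=
    contMDiffWithinAt_complex_mul h1 ((contDiffAt_inv ℝ hne).contMDiffAt.comp_contMDiffWithinAt x₀ h2)
  refine h3.congr_of_eventuallyEq ?_ (quot_eq_div hb _ (h0 x₀ hx₀))
  filter_upwards [mem_nhdsWithin_of_mem_nhds ((trivializationAt ℂ L x₀).open_baseSet.mem_nhds hb),
    self_mem_nhdsWithin] with y hy hyU
  exact quot_eq_div hy _ (h0 y hyU)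

lemma SmoothSection.smul {f : M → ℂ} {s : ∀ x : M, L x} {U : Opens M}
    (hf : ContMDiffOn 𝓘(ℝ, E) 𝓘(ℝ, ℂ) ∞ f U) (hs : SmoothSection E s U) :
    SmoothSection E (fun x => f x • s x) U := by
  intro x₀ hx₀
  have h := contMDiffWithinAt_section.1 (hs x₀ hx₀)
  refine contMDiffWithinAt_section.2 ((contMDiffWithinAt_complex_mul (hf x₀ hx₀) h).congr_of_eventuallyEq ?_ ?_)
  · filter_upwards [mem_nhdsWithin_of_mem_nhds ((trivializationAt ℂ L x₀).open_baseSet.mem_nhds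
      (mem_baseSet_trivializationAt ℂ L x₀))] with y hy
    exact ((trivializationAt ℂ L x₀).linear ℂ hy).map_smul (f y) (s y)
  · exact ((trivializationAt ℂ L x₀).linear ℂ
      (mem_baseSet_trivializationAt ℂ L x₀)).map_smul (f x₀) (s x₀)

lemma SmoothSection.mono {s : ∀ x : M, L x} {U V : Opens M} (hs : SmoothSection E s U)
    (h : V ≤ U) : SmoothSection E s V := ContMDiffOn.mono hs h

lemma conn_congr (Q : PrequantumStructure L Ω) {σ τ : ∀ x : M, L x} {U : Opens M}
    (hσ : SmoothSection E σ U) (h : ∀ x ∈ U, τ x = σ x) {x : M} (hx : x ∈ U) :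
    Q.conn τ x = Q.conn σ x :=
  Q.conn.isCovariantDerivativeOnUniv.congr_of_eventuallyEq
    ((hσ.congr h).mdifferentiableAt hx) (hσ.mdifferentiableAt hx) Filter.univ_mem
    (Filter.mem_of_superset (U.isOpen.mem_nhds hx) h)

/-- The connection obeys the Leibniz rule for real functions and commutes with multiplication by
`i`; splitting `f` into real and imaginary parts extends the rule to complex functions. -/
lemma conn_smul (Q : PrequantumStructure L Ω) {f : M → ℂ} {s : ∀ x : M, L x} {U : Opens M}
    (hf : ContMDiffOn 𝓘(ℝ, E) 𝓘(ℝ, ℂ) ∞ f U) (hs : SmoothSection E s U) {x : M} (hx : x ∈ U)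
    (v : TangentSpace 𝓘(ℝ, E) x) :
    Q.conn (fun y => f y • s y) x v = f x • Q.conn s x v + mvfderiv 𝓘(ℝ, E) f x v • s x := by
  have hfx : MDifferentiableAt 𝓘(ℝ, E) 𝓘(ℝ, ℂ) f x :=
    mdifferentiableAt_of_contMDiffOn hf hx
  have hre := Complex.reCLM.contDiff (n := ∞).contMDiff.comp_contMDiffOn hf
  have him := Complex.imCLM.contDiff (n := ∞).contMDiff.comp_contMDiffOn hf
  have dre : mvfderiv 𝓘(ℝ, E) (fun y => (f y).re) x v = (mvfderiv 𝓘(ℝ, E) f x v).re :=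
    mvfderiv_clm_comp Complex.reCLM hfx v
  have dim : mvfderiv 𝓘(ℝ, E) (fun y => (f y).im) x v = (mvfderiv 𝓘(ℝ, E) f x v).im :=
    mvfderiv_clm_comp Complex.imCLM hfx v
  have hI := hs.const_smul Complex.I
  have e : (fun y => f y • s y)
      = (fun y => (f y).re) • s + (fun y => (f y).im) • fun y => Complex.I • s y := by
    funext y
    simp only [Pi.add_apply, Pi.smul_apply', ← Complex.coe_smul (f y).re,
      ← Complex.coe_smul (f y).im, smul_smul, ← add_smul, Complex.re_add_im]
  have m1 : SmoothSection E ((fun y => (f y).re) • s) U := ContMDiffOn.smul_section hre hs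
  have m2 : SmoothSection E ((fun y => (f y).im) • fun y => Complex.I • s y) U :=
    ContMDiffOn.smul_section him hI
  have r1 : MDifferentiableAt 𝓘(ℝ, E) 𝓘(ℝ, ℝ) (fun y => (f y).re) x :=
    mdifferentiableAt_of_contMDiffOn hre hx
  have r2 : MDifferentiableAt 𝓘(ℝ, E) 𝓘(ℝ, ℝ) (fun y => (f y).im) x :=
    mdifferentiableAt_of_contMDiffOn him hx
  rw [e, Q.conn.isCovariantDerivativeOnUniv.add (m1.mdifferentiableAt hx)
    (m2.mdifferentiableAt hx),
    Q.conn.isCovariantDerivativeOnUniv.leibniz (hs.mdifferentiableAt hx) r1,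
    Q.conn.isCovariantDerivativeOnUniv.leibniz (hI.mdifferentiableAt hx) r2]
  simp only [add_apply, smul_apply, ContinuousLinearMap.smulRight_apply, dre, dim,
    Q.conn_I_smul U s hs x hx]
  conv_rhs => rw [← Complex.re_add_im (f x), ← Complex.re_add_im (mvfderiv 𝓘(ℝ, E) f x v),
    add_smul, add_smul, mul_smul, mul_smul, Complex.coe_smul, Complex.coe_smul, Complex.coe_smul,
    Complex.coe_smul]
  abel

lemma SmoothSection.conn_apply (Q : PrequantumStructure L Ω) {s : ∀ x : M, L x} {U : Opens M}
    (hs : SmoothSection E s U) {X : ∀ x : M, TangentSpace 𝓘(ℝ, E) x} (hX : SmoothField X U) :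
    SmoothSection E (fun x => Q.conn s x (X x)) U := by
  have h := (Q.conn_smooth U).contMDiff (σ := s) hs
  exact ContMDiffOn.clm_bundle_apply h hX

/-- The complex number `θ` with `∇_v s = i θ s`. -/
def theta (Q : PrequantumStructure L Ω) (s : ∀ x : M, L x) (x : M)
    (v : TangentSpace 𝓘(ℝ, E) x) : ℂ :=
  quot (-Complex.I • Q.conn s x v) (s x)

lemma conn_eq_theta_smul (Q : PrequantumStructure L Ω) {s : ∀ x : M, L x} {x : M} (h : s x ≠ 0)
    (v : TangentSpace 𝓘(ℝ, E) x) : Q.conn s x v = (Complex.I * theta Q s x v) • s x := by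
  rw [mul_smul, theta, quot_smul_self _ h, smul_smul]
  simp

lemma theta_eq_iff (Q : PrequantumStructure L Ω) {s : ∀ x : M, L x} {x : M} (h : s x ≠ 0)
    (v : TangentSpace 𝓘(ℝ, E) x) (z : ℂ) :
    theta Q s x v = z ↔ Q.conn s x v = (Complex.I * z) • s x := by
  rw [conn_eq_theta_smul Q h]
  refine ⟨fun hz => by rw [hz], fun hz => ?_⟩
  exact mul_left_cancel₀ Complex.I_ne_zero (smul_fiber_right_injective h hz)

lemma contMDiffOn_theta (Q : PrequantumStructure L Ω) {s : ∀ x : M, L x} {U : Opens M}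
    (hs : SmoothSection E s U) (h0 : ∀ x ∈ U, s x ≠ 0)
    {X : ∀ x : M, TangentSpace 𝓘(ℝ, E) x} (hX : SmoothField X U) :
    ContMDiffOn 𝓘(ℝ, E) 𝓘(ℝ, ℂ) ∞ (fun x => theta Q s x (X x)) U :=
  contMDiffOn_quot ((hs.conn_apply Q hX).const_smul _) hs h0

/-- The gauge law `θ_{fs} = θ_s - i df/f`. It is used to adjust a connection form by an exact form,
to compare frames with equal forms, and to see that locally constant rescaling changes nothing. -/
lemma theta_smul_section (Q : PrequantumStructure L Ω) {f : M → ℂ} {s : ∀ x : M, L x} {U : Opens M}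
    (hf : ContMDiffOn 𝓘(ℝ, E) 𝓘(ℝ, ℂ) ∞ f U) (hs : SmoothSection E s U) {x : M} (hx : x ∈ U)
    (hfx : f x ≠ 0) (h0 : s x ≠ 0) (v : TangentSpace 𝓘(ℝ, E) x) :
    theta Q (fun y => f y • s y) x v
      = theta Q s x v - Complex.I * (mvfderiv 𝓘(ℝ, E) f x v / f x) := by
  rw [theta_eq_iff Q (smul_ne_zero hfx h0), conn_smul Q hf hs hx, conn_eq_theta_smul Q h0,
    smul_smul, smul_smul, ← add_smul]
  congr 1
  field_simp
  linear_combination (mvfderiv 𝓘(ℝ, E) f x v) * Complex.I_sq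

/-- The curvature identity in a local frame: `dθ = Ω` on commuting vector fields. -/
lemma mvfderiv_theta_sub (Q : PrequantumStructure L Ω) {s : ∀ x : M, L x} {U : Opens M}
    (hs : SmoothSection E s U) (h0 : ∀ x ∈ U, s x ≠ 0)
    {X Y : ∀ x : M, TangentSpace 𝓘(ℝ, E) x} (hX : SmoothField X U) (hY : SmoothField Y U)
    {x : M} (hx : x ∈ U) (hXY : VectorField.mlieBracket 𝓘(ℝ, E) X Y x = 0) :
    mvfderiv 𝓘(ℝ, E) (fun y => theta Q s y (Y y)) x (X x)
      - mvfderiv 𝓘(ℝ, E) (fun y => theta Q s y (X y)) x (Y x) = Ω.toFun x (X x) (Y x) := by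
  -- In the frame, `∇_X ∇_Y s = (i X(θ(Y)) - θ(Y) θ(X)) s`. The quadratic term is symmetric in `X`
  -- and `Y` and drops out of the commutator.
  have hsub : ∀ {X Y : ∀ x : M, TangentSpace 𝓘(ℝ, E) x}, SmoothField X U → SmoothField Y U →
      Q.conn (fun y => Q.conn s y (Y y)) x (X x)
        = (Complex.I * mvfderiv 𝓘(ℝ, E) (fun y => theta Q s y (Y y)) x (X x)
          - theta Q s x (Y x) * theta Q s x (X x)) • s x := by
    intro X Y hX hY
    have hθ := contMDiffOn_theta Q hs h0 hY
    have hIs := hs.const_smul Complex.I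
    rw [conn_congr Q (SmoothSection.smul hθ hIs) (fun y hy => by
      rw [conn_eq_theta_smul Q (h0 y hy), smul_smul, mul_comm]) hx, conn_smul Q hθ hIs hx,
      Q.conn_I_smul U s hs x hx, conn_eq_theta_smul Q (h0 x hx), smul_smul, smul_smul, smul_smul,
      ← add_smul]
    congr 1
    linear_combination (theta Q s x (Y x) * theta Q s x (X x)) * Complex.I_sq
  have hc := Q.curvature U X Y s hX hY hs x hx
  rw [hsub hX hY, hsub hY hX, hXY, map_zero, sub_zero, ← sub_smul] at hc
  have := smul_fiber_right_injective (h0 x hx) hc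
  refine mul_left_cancel₀ Complex.I_ne_zero ?_
  linear_combination this

end LineBundle

end Prequantum

namespace Prequantum

universe u v

/-! ### Pullback of vector fields and of polarizations -/

section Fields

variable {E : Type*} [NormedAddCommGroup E] [NormedSpace ℝ E] [CompleteSpace E]
  {M : Type*} [TopologicalSpace M] [ChartedSpace E M] [IsManifold 𝓘(ℝ, E) ∞ M]
  {M' : Type*} [TopologicalSpace M'] [ChartedSpace E M'] [IsManifold 𝓘(ℝ, E) ∞ M']

lemma SmoothField.mpullback {f : M → M'} {U : Opens M} {V : Opens M'}
    (hf : ∀ x ∈ U, ContMDiffAt 𝓘(ℝ, E) 𝓘(ℝ, E) ∞ f x)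
    (hf' : ∀ x ∈ U, (mfderiv 𝓘(ℝ, E) 𝓘(ℝ, E) f x).IsInvertible) (hUV : ∀ x ∈ U, f x ∈ V)
    {X : ∀ x : M', TangentSpace 𝓘(ℝ, E) x} (hX : SmoothField X V) :
    SmoothField (VectorField.mpullback 𝓘(ℝ, E) 𝓘(ℝ, E) f X) U := fun x hx =>
  (ContMDiffAt.mpullback_vectorField_preimage (n := ∞)
    ((hX (f x) (hUV x hx)).contMDiffAt (V.isOpen.mem_nhds (hUV x hx))) (hf x hx) (hf' x hx)
    (by simp)).contMDiffWithinAt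

lemma SmoothField.mdifferentiableAt {X : ∀ x : M, TangentSpace 𝓘(ℝ, E) x} {U : Opens M}
    (hX : SmoothField X U) {x : M} (hx : x ∈ U) :
    MDifferentiableAt 𝓘(ℝ, E) (𝓘(ℝ, E).prod 𝓘(ℝ, E))
      (fun x => TotalSpace.mk' E (E := (TangentSpace 𝓘(ℝ, E) : M → Type _)) x (X x)) x :=
  ((hX x hx).contMDiffAt (U.isOpen.mem_nhds hx)).mdifferentiableAt (by simp)

lemma mlieBracket_mpullback {f : M → M'} {V : Opens M'} {x : M}
    (hf : ContMDiffAt 𝓘(ℝ, E) 𝓘(ℝ, E) ∞ f x) (hx : f x ∈ V)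
    {X Y : ∀ x : M', TangentSpace 𝓘(ℝ, E) x} (hX : SmoothField X V) (hY : SmoothField Y V) :
    VectorField.mlieBracket 𝓘(ℝ, E) (VectorField.mpullback 𝓘(ℝ, E) 𝓘(ℝ, E) f X)
        (VectorField.mpullback 𝓘(ℝ, E) 𝓘(ℝ, E) f Y) x
      = VectorField.mpullback 𝓘(ℝ, E) 𝓘(ℝ, E) f (VectorField.mlieBracket 𝓘(ℝ, E) X Y) x := by
  have hle : minSmoothness ℝ 2 ≤ (∞ : ℕ∞ω) := by
    rw [minSmoothness_of_isRCLikeNormedField]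
    exact WithTop.coe_le_coe.2 le_top
  have : IsManifold 𝓘(ℝ, E) (minSmoothness ℝ 2) M := IsManifold.of_le (n := ∞) hle
  have : IsManifold 𝓘(ℝ, E) (minSmoothness ℝ 2) M' := IsManifold.of_le (n := ∞) hle
  exact (VectorField.mpullback_mlieBracket (hX.mdifferentiableAt hx) (hY.mdifferentiableAt hx)
    hf hle).symm

end Fields

section Diffeo

variable {E : Type*} [NormedAddCommGroup E] [NormedSpace ℝ E]
  {M : Type u} [TopologicalSpace M] [ChartedSpace E M] [IsManifold 𝓘(ℝ, E) ∞ M]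
  (Φ : M ≃ₘ⟮𝓘(ℝ, E), 𝓘(ℝ, E)⟯ M)

lemma isInvertible_mfderiv_diffeo (x : M) : (mfderiv 𝓘(ℝ, E) 𝓘(ℝ, E) Φ x).IsInvertible :=
  ⟨Φ.mfderivToContinuousLinearEquiv (by simp) x,
    Φ.mfderivToContinuousLinearEquiv_coe (by simp)⟩

lemma mfderiv_mpullback_diffeo (X : ∀ x : M, TangentSpace 𝓘(ℝ, E) x) (x : M) :
    mfderiv 𝓘(ℝ, E) 𝓘(ℝ, E) Φ x (VectorField.mpullback 𝓘(ℝ, E) 𝓘(ℝ, E) Φ X x) = X (Φ x) :=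
  (isInvertible_mfderiv_diffeo Φ x).self_apply_inverse _

/-- The derivatives of `Φ` and `Φ⁻¹` are inverse to each other. -/
lemma apply_mfderiv_symm_mfderiv {β : Sort*} (C : ∀ x : M, TangentSpace 𝓘(ℝ, E) x → β) (x : M)
    (v : TangentSpace 𝓘(ℝ, E) x) :
    C (Φ.symm (Φ x)) (mfderiv 𝓘(ℝ, E) 𝓘(ℝ, E) Φ.symm (Φ x) (mfderiv 𝓘(ℝ, E) 𝓘(ℝ, E) Φ x v))
      = C x v := by
  have h1 := mfderiv_comp_apply x (Φ.symm.mdifferentiable (by simp) (Φ x))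
    (Φ.mdifferentiable (by simp) x) v
  have h2 : Φ.symm ∘ Φ = id := funext fun y => Φ.symm_apply_apply y
  rw [← h1, h2, mfderiv_id]
  -- `Φ.symm (Φ x)` and `x` are only propositionally equal, so the two vectors live in formally
  -- different tangent spaces, both unfolding to `E`. Generalizing the point permits substitution.
  have : ∀ (z : M) (hz : z = x) (w : E), w = v → C z w = C x v := by
    rintro z rfl w rfl
    rfl
  exact this _ (Φ.symm_apply_apply x) _ rfl

lemma SmoothField.mpullback_diffeo [CompleteSpace E] {X : ∀ x : M, TangentSpace 𝓘(ℝ, E) x}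
    {U : Opens M} (hX : SmoothField X U) :
    SmoothField (VectorField.mpullback 𝓘(ℝ, E) 𝓘(ℝ, E) Φ X) (Opens.comap (toCont Φ) U) :=
  SmoothField.mpullback (fun x _ => Φ.contMDiff x) (fun x _ => isInvertible_mfderiv_diffeo Φ x)
    (fun _ hx => hx) hX

/-- The relation between `P` and `P'` is symmetric under replacing Φ by its inverse, so every
statement proved for Φ also applies to `Φ.symm`. Keeping `P'` as a variable avoids having to
identify a double pullback of `P` with `P`. -/
lemma symm_relation {P P' : ∀ x : M, Submodule ℝ (TangentSpace 𝓘(ℝ, E) x)}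
    (h : ∀ x v, v ∈ P' x ↔ mfderiv 𝓘(ℝ, E) 𝓘(ℝ, E) Φ x v ∈ P (Φ x)) (y : M)
    (w : TangentSpace 𝓘(ℝ, E) y) :
    w ∈ P y ↔ mfderiv 𝓘(ℝ, E) 𝓘(ℝ, E) Φ.symm y w ∈ P' (Φ.symm y) := by
  obtain ⟨x, rfl⟩ := Φ.surjective y
  obtain ⟨v, rfl⟩ := (isInvertible_mfderiv_diffeo Φ x).surjective w
  exact (h x v).symm.trans (apply_mfderiv_symm_mfderiv Φ (fun x v => v ∈ P' x) x v).to_iff.symm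

lemma IsFieldIn.mpullback_diffeo [CompleteSpace E]
    {P P' : ∀ x : M, Submodule ℝ (TangentSpace 𝓘(ℝ, E) x)}
    (h : ∀ x v, v ∈ P' x ↔ mfderiv 𝓘(ℝ, E) 𝓘(ℝ, E) Φ x v ∈ P (Φ x)) {U : Opens M}
    {X : ∀ x : M, TangentSpace 𝓘(ℝ, E) x} (hX : IsFieldIn P U X) :
    IsFieldIn P' (Opens.comap (toCont Φ) U) (VectorField.mpullback 𝓘(ℝ, E) 𝓘(ℝ, E) Φ X) :=
  ⟨hX.1.mpullback_diffeo Φ, fun x hx => by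
    rw [h, mfderiv_mpullback_diffeo]
    exact hX.2 _ hx⟩

lemma comap_symm_comap (U : Opens M) :
    Opens.comap (toCont Φ) (Opens.comap (toCont Φ.symm) U) = U := by
  ext x
  change Φ.symm (Φ x) ∈ U ↔ x ∈ U
  rw [Φ.symm_apply_apply]

lemma mpullback_mpullback_symm (X : ∀ x : M, TangentSpace 𝓘(ℝ, E) x) :
    VectorField.mpullback 𝓘(ℝ, E) 𝓘(ℝ, E) Φ (VectorField.mpullback 𝓘(ℝ, E) 𝓘(ℝ, E) Φ.symm X)
      = X := by
  funext x
  apply (isInvertible_mfderiv_diffeo Φ x).injective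
  rw [mfderiv_mpullback_diffeo]
  apply (isInvertible_mfderiv_diffeo Φ.symm (Φ x)).injective
  rw [mfderiv_mpullback_diffeo]
  exact (apply_mfderiv_symm_mfderiv Φ (β := E) (fun x v => X x) x (X x)).trans
    (apply_mfderiv_symm_mfderiv Φ (β := E) (fun x v => v) x (X x)).symm

/-- Fields in `P` and in `Φ(P)` correspond under pullback by Φ and by `Φ.symm`, so each axiom is
moved to the target, applied there, and moved back. -/
lemma IsPolarization.pullback [CompleteSpace E] {Ω : SymplecticForm E M}
    {P : ∀ x : M, Submodule ℝ (TangentSpace 𝓘(ℝ, E) x)} (hP : IsPolarization Ω P)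
    (hΦ : IsSymplectomorphism Ω Φ) : IsPolarization Ω (pullbackPolarization Φ P) := by
  have hrel : ∀ x v, v ∈ pullbackPolarization Φ P x ↔
      mfderiv 𝓘(ℝ, E) 𝓘(ℝ, E) Φ x v ∈ P (Φ x) := fun x v => Iff.rfl
  have hrel' := symm_relation Φ hrel
  refine ⟨?_, ?_, ?_, ?_⟩
  · intro x v hv
    obtain ⟨U, hxU, X, hX, hXv⟩ := hP.smooth (Φ x) _ hv
    refine ⟨Opens.comap (toCont Φ) U, hxU, _, hX.mpullback_diffeo Φ hrel, ?_⟩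
    apply (isInvertible_mfderiv_diffeo Φ x).injective
    rw [mfderiv_mpullback_diffeo]
    exact hXv
  · intro U X Y hX hY
    have h1 := hX.mpullback_diffeo Φ.symm hrel'
    have h2 := hY.mpullback_diffeo Φ.symm hrel'
    have h3 := (hP.involutive _ _ _ h1 h2).mpullback_diffeo Φ hrel
    rw [comap_symm_comap] at h3
    -- Each field is the Φ-pullback of its push-forward, so naturality expresses the bracket as the
    -- pullback of a bracket of fields in `P`.
    have h4 : ∀ x ∈ U, VectorField.mlieBracket 𝓘(ℝ, E) X Y x
        = VectorField.mpullback 𝓘(ℝ, E) 𝓘(ℝ, E) Φ (VectorField.mlieBracket 𝓘(ℝ, E)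
          (VectorField.mpullback 𝓘(ℝ, E) 𝓘(ℝ, E) Φ.symm X)
          (VectorField.mpullback 𝓘(ℝ, E) 𝓘(ℝ, E) Φ.symm Y)) x := fun x hx => by
      rw [← mlieBracket_mpullback (Φ.contMDiff x) (V := Opens.comap (toCont Φ.symm) U) ?_ h1.1 h2.1,
        mpullback_mpullback_symm, mpullback_mpullback_symm]
      change Φ.symm (Φ x) ∈ U
      rwa [Φ.symm_apply_apply]
    exact ⟨ContMDiffOn.congr h3.1 fun x hx => by rw [h4 x hx], fun x hx => by
      rw [h4 x hx]
      exact h3.2 x hx⟩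
  · intro x
    obtain ⟨U, hxU, k, X, hX, hgen⟩ := hP.locally_finitely_generated (Φ x)
    refine ⟨Opens.comap (toCont Φ) U, hxU, k, _, fun i => (hX i).mpullback_diffeo Φ hrel,
      fun Y hY => ?_⟩
    -- `Y` is pushed forward to `U` and expanded there in the generators of `P`; composing the
    -- coefficients with Φ gives the expansion of `Y`.
    have h1 := hY.mpullback_diffeo Φ.symm hrel'
    have e : Opens.comap (toCont Φ.symm) (Opens.comap (toCont Φ) U) = U :=
      comap_symm_comap Φ.symm U
    rw [e] at h1
    obtain ⟨f, hf, hfY⟩ := hgen _ h1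
    refine ⟨fun i y => f i (Φ y), fun i => ?_, fun y hy => ?_⟩
    · exact (hf i).comp Φ.contMDiff.contMDiffOn fun _ h => h
    · apply (isInvertible_mfderiv_diffeo Φ y).injective
      rw [map_sum]
      simp only [map_smul, mfderiv_mpullback_diffeo]
      rw [← hfY (Φ y) hy, ← mfderiv_mpullback_diffeo Φ
        (VectorField.mpullback 𝓘(ℝ, E) 𝓘(ℝ, E) Φ.symm Y), mpullback_mpullback_symm]
  · obtain ⟨U, hU, h⟩ := hP.generically_lagrangian
    refine ⟨Opens.comap (toCont Φ) U, hU.preimage Φ.toHomeomorph.isOpenMap, fun x hx v => ?_⟩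
    rw [hrel, h (Φ x) hx]
    refine ⟨fun H w hw => ?_, fun H w hw => ?_⟩
    · rw [← hΦ]
      exact H _ hw
    · obtain ⟨w, rfl⟩ := (isInvertible_mfderiv_diffeo Φ x).surjective w
      rw [hΦ]
      exact H w hw

end Diffeo

end Prequantum

namespace Prequantum

universe u v

variable {E : Type*} [NormedAddCommGroup E] [NormedSpace ℝ E]
  {M : Type u} [TopologicalSpace M] [ChartedSpace E M]
  [IsManifold 𝓘(ℝ, E) ∞ M]

/-! ### Transport of sections between corresponding frames -/

section LineBundle

variable {L : M → Type v} [TopologicalSpace (TotalSpace ℂ L)]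
  [∀ x, AddCommGroup (L x)] [∀ x, Module ℂ (L x)] [∀ x, TopologicalSpace (L x)]
  [∀ x, IsTopologicalAddGroup (L x)] [∀ x, ContinuousSMul ℝ (L x)]
  [FiberBundle ℂ L] [VectorBundle ℝ ℂ L] [VectorBundle ℂ ℂ L]
  {Ω : SymplecticForm E M}

lemma quot_add {x : M} (v w u : L x) : quot (v + w) u = quot v u + quot w u := by
  have h := ((trivializationAt ℂ L x).linear ℂ (mem_baseSet_trivializationAt ℂ L x)).map_add v w
  rw [quot, h, add_div, quot, quot]

lemma quot_smul_left {x : M} (z : ℂ) (v u : L x) : quot (z • v) u = z * quot v u := by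
  have h := ((trivializationAt ℂ L x).linear ℂ (mem_baseSet_trivializationAt ℂ L x)).map_smul z v
  rw [quot, h, smul_eq_mul, mul_div_assoc, quot]

lemma quot_zero_left {x : M} (u : L x) : quot 0 u = 0 := by
  simpa using quot_smul_left 0 0 u

/-- Local frames `s_α` over `U_α` and `t_α` over `U'_α = Φ⁻¹(U_α)` whose local data correspond to
each other under `Φ`. -/
structure FramePair (Q : PrequantumStructure L Ω) (Φ : M ≃ₘ⟮𝓘(ℝ, E), 𝓘(ℝ, E)⟯ M) where
  ι : Type*
  U : ι → Opens M
  U' : ι → Opens M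
  s : ι → ∀ x : M, L x
  t : ι → ∀ x : M, L x
  mem_iff : ∀ α x, x ∈ U' α ↔ Φ x ∈ U α
  covers : ∀ x, ∃ α, x ∈ U α
  smooth_s : ∀ α, SmoothSection E (s α) (U α)
  smooth_t : ∀ α, SmoothSection E (t α) (U' α)
  s_ne_zero : ∀ α, ∀ x ∈ U α, s α x ≠ 0
  t_ne_zero : ∀ α, ∀ x ∈ U' α, t α x ≠ 0
  transition_eq : ∀ α β x, x ∈ U' α → x ∈ U' β →
    quot (t α x) (t β x) = quot (s α (Φ x)) (s β (Φ x))
  theta_eq : ∀ α, ∀ x ∈ U' α, ∀ v : TangentSpace 𝓘(ℝ, E) x,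
    theta Q (t α) x v = theta Q (s α) (Φ x) (mfderiv 𝓘(ℝ, E) 𝓘(ℝ, E) Φ x v)

namespace FramePair

variable {Q : PrequantumStructure L Ω} {Φ : M ≃ₘ⟮𝓘(ℝ, E), 𝓘(ℝ, E)⟯ M} (D : FramePair Q Φ)

/-- Exchanging the two families of frames. -/
def symm : FramePair Q Φ.symm where
  ι := D.ι
  U := D.U'
  U' := D.U
  s := D.t
  t := D.s
  mem_iff α x := by rw [D.mem_iff, Φ.apply_symm_apply]
  covers x := (D.covers (Φ x)).imp fun α h => (D.mem_iff α x).2 h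
  smooth_s := D.smooth_t
  smooth_t := D.smooth_s
  s_ne_zero := D.t_ne_zero
  t_ne_zero := D.s_ne_zero
  transition_eq α β y hα hβ := by
    obtain ⟨x, rfl⟩ : ∃ x, Φ x = y := Φ.surjective y
    rw [← D.transition_eq α β x ((D.mem_iff α x).2 hα) ((D.mem_iff β x).2 hβ)]
    exact congrArg (fun z => quot (D.t α z) (D.t β z)) (Φ.symm_apply_apply x).symm
  theta_eq α y hα v := by
    obtain ⟨x, rfl⟩ : ∃ x, Φ x = y := Φ.surjective y
    obtain ⟨v, rfl⟩ := (isInvertible_mfderiv_diffeo Φ x).surjective v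
    rw [← D.theta_eq α x ((D.mem_iff α x).2 hα)]
    exact (apply_mfderiv_symm_mfderiv Φ (fun z w => theta Q (D.t α) z w) x v).symm

/-- The section `((σ / s_α) ∘ Φ) t_α` over `W ⊆ Φ⁻¹(V)`, for a section `σ` over `V`. -/
def transport {V W : Opens M} (h : W ≤ Opens.comap (toCont Φ) V) (σ : ∀ x : V, L x) (x : W) :
    L x :=
  quot (σ ⟨Φ x, h x.2⟩) (D.s (D.covers (Φ x)).choose (Φ x)) • D.t (D.covers (Φ x)).choose x

/-- Passing from one index to another multiplies the frame `t` by the pulled-back transition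
function and divides the coefficient by the same number, so the index chosen in `transport` is
immaterial. -/
lemma transport_eq {V W : Opens M} (h : W ≤ Opens.comap (toCont Φ) V) (σ : ∀ x : V, L x) (x : W)
    {α : D.ι} (hα : Φ x ∈ D.U α) :
    D.transport h σ x = quot (σ ⟨Φ x, h x.2⟩) (D.s α (Φ x)) • D.t α x := by
  have hβ := (D.covers (Φ x)).choose_spec
  rw [transport]
  generalize (D.covers (Φ x)).choose = β at hβ
  have ht := D.transition_eq β α x ((D.mem_iff β x).2 hβ) ((D.mem_iff α x).2 hα)
  have hsα := D.s_ne_zero α _ hα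
  rw [← quot_smul_self (D.t β x) (D.t_ne_zero α _ ((D.mem_iff α x).2 hα)), ht, smul_smul,
    ← quot_smul_left, quot_smul_self _ (D.s_ne_zero β _ hβ)]

lemma transport_add {V W : Opens M} (h : W ≤ Opens.comap (toCont Φ) V) (σ σ' : ∀ x : V, L x) :
    D.transport h (σ + σ') = D.transport h σ + D.transport h σ' := by
  funext x
  simp only [transport, Pi.add_apply, quot_add, add_smul]

lemma transport_smul {V W : Opens M} (h : W ≤ Opens.comap (toCont Φ) V) (z : ℂ)
    (σ : ∀ x : V, L x) : D.transport h (z • σ) = z • D.transport h σ := by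
  funext x
  simp only [transport, Pi.smul_apply, quot_smul_left, smul_smul]

lemma transport_symm_transport {V W V' : Opens M} (h : W ≤ Opens.comap (toCont Φ) V)
    (h' : V' ≤ Opens.comap (toCont Φ.symm) W) (hV : V' ≤ V) (σ : ∀ x : V, L x) :
    D.symm.transport h' (D.transport h σ) = fun x : V' => σ ⟨x, hV x.2⟩ := by
  funext y
  obtain ⟨α, hα⟩ := D.covers y
  have hα' : Φ (Φ.symm y) ∈ D.U α := by rwa [Φ.apply_symm_apply]
  have hα'' := (D.mem_iff α (Φ.symm y)).2 hα'
  refine (D.symm.transport_eq h' _ y (α := α) hα'').trans ?_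
  change quot (D.transport h σ ⟨Φ.symm y, _⟩) (D.t α (Φ.symm y)) • D.s α y = _
  rw [D.transport_eq h σ ⟨Φ.symm y, h' y.2⟩ hα', quot_smul_right _ (D.t_ne_zero α _ hα'')]
  have e : (⟨Φ (Φ.symm y), h (h' y.2)⟩ : V) = ⟨y, hV y.2⟩ := Subtype.ext (Φ.apply_symm_apply _)
  have := congrArg (fun z : V => quot (σ z) (D.s α z)) e
  exact (congrArg (· • D.s α y) this).trans (quot_smul_self _ (D.s_ne_zero α _ hα))

lemma transport_transport_symm {V W W' : Opens M} (h : V ≤ Opens.comap (toCont Φ.symm) W)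
    (h' : W' ≤ Opens.comap (toCont Φ) V) (hW : W' ≤ W) (σ : ∀ x : W, L x) :
    D.transport h' (D.symm.transport h σ) = fun x : W' => σ ⟨x, hW x.2⟩ := by
  funext x
  obtain ⟨α, hα⟩ := D.covers (Φ x)
  have hα' := (D.mem_iff α x).2 hα
  have hα'' : Φ.symm (Φ x) ∈ D.U' α := by rwa [Φ.symm_apply_apply]
  rw [D.transport_eq h' _ x hα, D.symm.transport_eq h σ ⟨Φ x, h' x.2⟩ (α := α) hα'']
  change quot (_ • D.s α (Φ x)) (D.s α (Φ x)) • _ = _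
  rw [quot_smul_right _ (D.s_ne_zero α _ hα)]
  have e : (⟨Φ.symm (Φ x), h (h' x.2)⟩ : W) = ⟨x, hW x.2⟩ := Subtype.ext (Φ.symm_apply_apply _)
  have := congrArg (fun z : W => quot (σ z) (D.t α z)) e
  exact (congrArg (· • D.t α x) this).trans (quot_smul_self _ (D.t_ne_zero α _ hα'))

/-- With `σ = g s_α`, the transport is `(g ∘ Φ) t_α`. Expanding both covariant derivatives by the
Leibniz rule gives `dg + i g θ` and its pullback as coefficients, so `∇_v` of the transport is the
transport of `∇_{Φ_* v} σ`. -/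
lemma transport_local {V W : Opens M} (h : W ≤ Opens.comap (toCont Φ) V) {σ : ∀ x : V, L x}
    (hσ : SmoothSection E (extendZero σ) V) {x : M} (hx : x ∈ W) {α : D.ι} (hα : Φ x ∈ D.U α) :
    SmoothSection E (extendZero (D.transport h σ)) (W ⊓ D.U' α) ∧
    ∀ v : TangentSpace 𝓘(ℝ, E) x, Q.conn (extendZero (D.transport h σ)) x v
      = quot (Q.conn (extendZero σ) (Φ x) (mfderiv 𝓘(ℝ, E) 𝓘(ℝ, E) Φ x v)) (D.s α (Φ x))
        • D.t α x := by
  have hxα := (D.mem_iff α x).2 hα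
  have hs := (D.smooth_s α).mono (inf_le_right : V ⊓ D.U α ≤ D.U α)
  have ht := (D.smooth_t α).mono (inf_le_right : W ⊓ D.U' α ≤ D.U' α)
  have hg := contMDiffOn_quot (hσ.mono (inf_le_left : V ⊓ D.U α ≤ V)) hs
    fun y hy => D.s_ne_zero α y hy.2
  set g : M → ℂ := fun y => quot (extendZero σ y) (D.s α y) with hgdef
  have hmem : ∀ y ∈ W ⊓ D.U' α, Φ y ∈ V ⊓ D.U α := fun y hy =>
    ⟨h hy.1, (D.mem_iff α y).1 hy.2⟩
  have hgΦ : ContMDiffOn 𝓘(ℝ, E) 𝓘(ℝ, ℂ) ∞ (fun y => g (Φ y)) (W ⊓ D.U' α : Opens M) :=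
    hg.comp Φ.contMDiff.contMDiffOn hmem
  have hτ : ∀ y ∈ W ⊓ D.U' α, extendZero (D.transport h σ) y = g (Φ y) • D.t α y := fun y hy => by
    rw [extendZero_of_mem _ hy.1, D.transport_eq h σ ⟨y, hy.1⟩ (hmem y hy).2, hgdef]
    simp only
    rw [extendZero_of_mem σ (hmem y hy).1]
  have hprod := SmoothSection.smul hgΦ ht
  refine ⟨hprod.congr hτ, fun v => ?_⟩
  have hx' : x ∈ W ⊓ D.U' α := ⟨hx, hxα⟩
  have hs0 := D.s_ne_zero α _ hα
  have hσg : ∀ y ∈ V ⊓ D.U α, extendZero σ y = g y • D.s α y := fun y hy =>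
    (quot_smul_self _ (D.s_ne_zero α y hy.2)).symm
  rw [conn_congr Q hprod hτ hx', conn_smul Q hgΦ ht hx',
    conn_congr Q (SmoothSection.smul hg hs) hσg (hmem x hx'), conn_smul Q hg hs (hmem x hx'),
    conn_eq_theta_smul Q (D.t_ne_zero α x hxα), conn_eq_theta_smul Q hs0, D.theta_eq α x hxα,
    mvfderiv_comp_mfderiv (mdifferentiableAt_of_contMDiffOn hg (hmem x hx'))
      (Φ.mdifferentiable (by simp) x), smul_smul, smul_smul, ← add_smul, ← add_smul,
    quot_smul_right _ hs0]

end FramePair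

/-! ### Transport of polarized sections and the induced isomorphism -/

section Sheaf

variable [FiniteDimensional ℝ E] [T2Space M]

/-- Every vector of `P x` extends to a local field in `P`, and a bump function spreads it over all
of `U`. Polarization thus becomes a pointwise condition, which can be compared directly through the
derivative of Φ. -/
lemma mem_polarizedSections_iff (Q : PrequantumStructure L Ω)
    {P : ∀ x : M, Submodule ℝ (TangentSpace 𝓘(ℝ, E) x)} (hP : IsPolarization Ω P) {U : Opens M}
    {s : ∀ x : U, L x} : s ∈ polarizedSections Q P U ↔ SmoothSection E (extendZero s) U ∧
      ∀ x ∈ U, ∀ v ∈ P x, Q.conn (extendZero s) x v = 0 := by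
  refine and_congr_right fun _ => ⟨fun h x hx v hv => ?_, fun h X hX x hx => h x hx _ (hX.2 x hx)⟩
  obtain ⟨V, hxV, X, hX, rfl⟩ := hP.smooth x v hv
  obtain ⟨Y, hY, hYX⟩ := exists_field_extension P U X hX hxV
  rw [← hYX]
  exact h Y hY x hx

namespace FramePair

variable {Q : PrequantumStructure L Ω} {Φ : M ≃ₘ⟮𝓘(ℝ, E), 𝓘(ℝ, E)⟯ M} (D : FramePair Q Φ)
  {P P' : ∀ x : M, Submodule ℝ (TangentSpace 𝓘(ℝ, E) x)}

lemma transport_mem (hP : IsPolarization Ω P) (hP' : IsPolarization Ω P')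
    (hrel : ∀ x v, v ∈ P' x ↔ mfderiv 𝓘(ℝ, E) 𝓘(ℝ, E) Φ x v ∈ P (Φ x)) {V W : Opens M}
    (h : W ≤ Opens.comap (toCont Φ) V) {σ : ∀ x : V, L x} (hσ : σ ∈ polarizedSections Q P V) :
    D.transport h σ ∈ polarizedSections Q P' W := by
  rw [mem_polarizedSections_iff Q hP] at hσ
  rw [mem_polarizedSections_iff Q hP']
  refine ⟨fun x hx => ?_, fun x hx v hv => ?_⟩
  · obtain ⟨α, hα⟩ := D.covers (Φ x)
    have hx' : x ∈ W ⊓ D.U' α := ⟨hx, (D.mem_iff α x).2 hα⟩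
    exact (((D.transport_local h hσ.1 hx hα).1 x hx').contMDiffAt
      ((W ⊓ D.U' α).isOpen.mem_nhds hx')).contMDiffWithinAt
  · obtain ⟨α, hα⟩ := D.covers (Φ x)
    rw [(D.transport_local h hσ.1 hx hα).2, hσ.2 (Φ x) (h hx) _ ((hrel x v).1 hv), quot_zero_left,
      zero_smul]

/-- Transport of polarized sections as a map of sheaves over `Φ`. -/
def comorphism (hP : IsPolarization Ω P) (hP' : IsPolarization Ω P')
    (hrel : ∀ x v, v ∈ P' x ↔ mfderiv 𝓘(ℝ, E) 𝓘(ℝ, E) Φ x v ∈ P (Φ x)) :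
    Cech.Comorphism (polarizedSheaf Q P) (toCont Φ) (polarizedSheaf Q P') where
  app {_ W} h :=
    { toFun := fun σ => (⟨D.transport h σ.1, D.transport_mem hP hP' hrel h σ.2⟩ :
        polarizedSections Q P' W)
      map_add' := fun σ τ => Subtype.ext (D.transport_add h σ.1 τ.1)
      map_smul' := fun z σ => Subtype.ext (D.transport_smul h z σ.1) }
  -- The index chosen in `transport` depends only on the point, not on the open sets, so restriction
  -- commutes with transport definitionally.
  naturality _ _ _ _ _ := rfl

/-- The isomorphism of sheaf quantizations induced by a pair of corresponding frames. -/
def quantizationEquiv (hP : IsPolarization Ω P) (hP' : IsPolarization Ω P')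
    (hrel : ∀ x v, v ∈ P' x ↔ mfderiv 𝓘(ℝ, E) 𝓘(ℝ, E) Φ x v ∈ P (Φ x)) (n : ℕ) :
    Cech.H (polarizedSheaf Q P) n ≃ₗ[ℂ] Cech.H (polarizedSheaf Q P') n :=
  (D.comorphism hP hP' hrel).equivH (D.symm.comorphism hP' hP (symm_relation Φ hrel))
    Φ.apply_symm_apply Φ.symm_apply_apply
    (fun h h' hV σ => Subtype.ext (D.transport_symm_transport h h' hV σ.1))
    (fun h h' hW σ => Subtype.ext (D.transport_transport_symm h h' hW σ.1)) n

end FramePair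

/-- The frame pair of complementary trivialization covers. -/
def IsComplementary.framePair {Q : PrequantumStructure L Ω} {Φ : M ≃ₘ⟮𝓘(ℝ, E), 𝓘(ℝ, E)⟯ M}
    {𝒰 : Cech.OpenCover M} {S : Trivializations E L 𝒰}
    {T : Trivializations E L (𝒰.pullback (toCont Φ))} (h : IsComplementary Q Φ S T) :
    FramePair Q Φ where
  ι := 𝒰.ι
  U := 𝒰.U
  U' := (𝒰.pullback (toCont Φ)).U
  s := S.s
  t := T.s
  mem_iff _ _ := Iff.rfl
  covers := 𝒰.covers
  smooth_s := S.smooth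
  smooth_t := T.smooth
  s_ne_zero := S.ne_zero
  t_ne_zero := T.ne_zero
  transition_eq := h.1
  theta_eq := h.2

/-- The degreewise isomorphisms are summed. A representing cocycle lives on the pulled-back cover
itself, because transport acts componentwise on cochains, so no further refinement is needed. -/
lemma IsComplementary.exists_isInducedBy {Q : PrequantumStructure L Ω}
    {Φ : M ≃ₘ⟮𝓘(ℝ, E), 𝓘(ℝ, E)⟯ M} {P : ∀ x : M, Submodule ℝ (TangentSpace 𝓘(ℝ, E) x)}
    (hP : IsPolarization Ω P) (hΦ : IsSymplectomorphism Ω Φ)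
    {𝒰 : Cech.OpenCover M} {S : Trivializations E L 𝒰}
    {T : Trivializations E L (𝒰.pullback (toCont Φ))} (h : IsComplementary Q Φ S T) :
    ∃ e : SheafQuantization Q P ≃ₗ[ℂ] SheafQuantization Q (pullbackPolarization Φ P),
      IsInducedBy Q P Φ S T e := by
  have hP' := hP.pullback Φ hΦ
  let D := h.framePair
  let e := D.quantizationEquiv hP hP' fun _ _ => Iff.rfl
  refine ⟨DFinsupp.mapRange.linearEquiv e, fun n 𝒱 c =>
    ⟨(D.comorphism hP hP' fun _ _ => Iff.rfl).mapCocycle 𝒱 n c, fun A α x hV hW hα => ?_, ?_⟩⟩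
  · exact D.transport_eq (Cech.Comorphism.inter_pullback_le 𝒱 (toCont Φ) A) (c.1 A).1 ⟨x, hW⟩
      (α := α) hα
  · rw [← Cech.Comorphism.mapH_cocycleClass]
    exact DFinsupp.mapRange_single (hf := fun i => (e i).map_zero)

end Sheaf

end LineBundle

end Prequantum

namespace Prequantum

universe u v

/-! ### Coordinate fields, locally constant functions and the Poincaré lemma -/

section Chart

variable {E : Type*} [NormedAddCommGroup E] [NormedSpace ℝ E]
  {M : Type*} [TopologicalSpace M] [ChartedSpace E M]

variable (E) in
/-- The domain of the chart at `x₀`. -/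
def chartDomain (x₀ : M) : Opens M := ⟨(chartAt E x₀).source, (chartAt E x₀).open_source⟩

/-- A constant vector field on a vector space. -/
def constField (v : E) : ∀ x : E, TangentSpace 𝓘(ℝ, E) x := fun _ => v

variable (E) in
/-- The coordinate vector field of the chart at `x₀` in the direction `v`. -/
def coordField (x₀ : M) (v : E) : ∀ x : M, TangentSpace 𝓘(ℝ, E) x :=
  VectorField.mpullback 𝓘(ℝ, E) 𝓘(ℝ, E) (extChartAt 𝓘(ℝ, E) x₀) (constField v)

variable [IsManifold 𝓘(ℝ, E) ∞ M] (x₀ : M)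

variable {x₀} in
lemma isInvertible_mfderiv_chart {x : M} (hx : x ∈ chartDomain E x₀) :
    (mfderiv 𝓘(ℝ, E) 𝓘(ℝ, E) (extChartAt 𝓘(ℝ, E) x₀) x).IsInvertible := by
  have : IsManifold 𝓘(ℝ, E) 1 M := IsManifold.of_le (n := ∞) (by simp)
  exact isInvertible_mfderiv_extChartAt (by rwa [extChartAt_source])

lemma contMDiffAt_chart {x : M} (hx : x ∈ chartDomain E x₀) :
    ContMDiffAt 𝓘(ℝ, E) 𝓘(ℝ, E) ∞ (extChartAt 𝓘(ℝ, E) x₀) x := contMDiffAt_extChartAt' hx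

lemma smoothField_constField (v : E) : SmoothField (constField v) ⊤ :=
  (contMDiff_vectorSpace_iff_contDiff.2 contDiff_const).contMDiffOn

variable {x₀}

lemma mfderiv_chart_coordField {x : M} (hx : x ∈ chartDomain E x₀) (v : E) :
    mfderiv 𝓘(ℝ, E) 𝓘(ℝ, E) (extChartAt 𝓘(ℝ, E) x₀) x (coordField E x₀ v x) = v :=
  (isInvertible_mfderiv_chart hx).self_apply_inverse _

lemma smoothField_coordField [CompleteSpace E] (v : E) :
    SmoothField (coordField E x₀ v) (chartDomain E x₀) :=
  SmoothField.mpullback (V := ⊤) (fun _ hx => contMDiffAt_chart x₀ hx)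
    (fun _ hx => isInvertible_mfderiv_chart hx) (fun _ _ => trivial) (smoothField_constField v)

/-- Coordinate fields are pullbacks of constant fields, and brackets commute with pullback. Testing
the curvature on such fields removes its bracket term. -/
lemma mlieBracket_coordField [CompleteSpace E] {x : M} (hx : x ∈ chartDomain E x₀) (v w : E) :
    VectorField.mlieBracket 𝓘(ℝ, E) (coordField E x₀ v) (coordField E x₀ w) x = 0 := by
  have h : VectorField.mlieBracket 𝓘(ℝ, E) (constField v) (constField w) = 0 := by
    rw [← VectorField.mlieBracketWithin_univ, VectorField.mlieBracketWithin_eq_lieBracketWithin]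
    change VectorField.lieBracketWithin ℝ (fun _ : E => v) (fun _ => w) Set.univ = fun _ => 0
    rw [VectorField.lieBracketWithin_univ, VectorField.lieBracket_eq]
    funext y
    simp
  rw [coordField, coordField, mlieBracket_mpullback (contMDiffAt_chart x₀ hx) (V := ⊤) trivial
    (smoothField_constField v) (smoothField_constField w), h, VectorField.mpullback_zero]
  rfl

lemma exists_chart_ball {W : Opens M} (h : x₀ ∈ W) : ∃ r > 0,
    Metric.ball (extChartAt 𝓘(ℝ, E) x₀ x₀) r ⊆ (extChartAt 𝓘(ℝ, E) x₀).target ∧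
    ∀ e ∈ Metric.ball (extChartAt 𝓘(ℝ, E) x₀ x₀) r, (extChartAt 𝓘(ℝ, E) x₀).symm e ∈ W := by
  have h1 := (isOpen_extChartAt_target (I := 𝓘(ℝ, E)) x₀).mem_nhds (mem_extChartAt_target x₀)
  have h2 := (continuousAt_extChartAt_symm (I := 𝓘(ℝ, E)) x₀).preimage_mem_nhds
    (by rw [extChartAt_to_inv]; exact W.isOpen.mem_nhds h)
  obtain ⟨r, hr, hball⟩ := Metric.mem_nhds_iff.1 (Filter.inter_mem h1 h2)
  exact ⟨r, hr, fun e he => (hball he).1, fun e he => (hball he).2⟩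

/-- The preimage in `M` of a ball in the chart at `x₀`. -/
def chartBall (x₀ : M) (r : ℝ) : Opens M :=
  ⟨(extChartAt 𝓘(ℝ, E) x₀).source ∩
      extChartAt 𝓘(ℝ, E) x₀ ⁻¹' Metric.ball (extChartAt 𝓘(ℝ, E) x₀ x₀) r,
    (continuousOn_extChartAt x₀).isOpen_inter_preimage (isOpen_extChartAt_source x₀)
      Metric.isOpen_ball⟩

/-- A smooth function whose derivative vanishes is locally constant. -/
lemma eventually_eq_of_mvfderiv_eq_zero {f : M → ℂ} {W : Opens M}
    (hf : ContMDiffOn 𝓘(ℝ, E) 𝓘(ℝ, ℂ) ∞ f W)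
    (hd : ∀ x ∈ W, ∀ v, mvfderiv 𝓘(ℝ, E) f x v = 0) (hx : x₀ ∈ W) : ∀ᶠ y in 𝓝 x₀, f y = f x₀ := by
  obtain ⟨r, hr, hball, hW⟩ := exists_chart_ball (E := E) hx
  have hsm := (contMDiffOn_extChartAt_symm (I := 𝓘(ℝ, E)) (n := ∞) x₀).mono hball
  have hg : ContMDiffOn 𝓘(ℝ, E) 𝓘(ℝ, ℂ) ∞ (fun e => f ((extChartAt 𝓘(ℝ, E) x₀).symm e))
      (Metric.ball (extChartAt 𝓘(ℝ, E) x₀ x₀) r) := hf.comp hsm hW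
  have hconst : ∀ e ∈ Metric.ball (extChartAt 𝓘(ℝ, E) x₀ x₀) r,
      f ((extChartAt 𝓘(ℝ, E) x₀).symm e)
        = f ((extChartAt 𝓘(ℝ, E) x₀).symm (extChartAt 𝓘(ℝ, E) x₀ x₀)) := fun e he => by
    refine Metric.isOpen_ball.is_const_of_fderiv_eq_zero (𝕜 := ℝ)
      (f := fun e => f ((extChartAt 𝓘(ℝ, E) x₀).symm e))
      (convex_ball _ _).isPreconnected
      ((contMDiffOn_iff_contDiffOn.1 hg).differentiableOn (by simp)) (fun e he => ?_) he
      (Metric.mem_ball_self hr)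
    ext v
    have h1 : MDifferentiableAt 𝓘(ℝ, E) 𝓘(ℝ, E) (extChartAt 𝓘(ℝ, E) x₀).symm e :=
      ((hsm e he).contMDiffAt (Metric.isOpen_ball.mem_nhds he)).mdifferentiableAt (by simp)
    have h2 := mvfderiv_comp_mfderiv (mdifferentiableAt_of_contMDiffOn hf (hW e he)) h1 v
    rw [hd _ (hW e he)] at h2
    rw [mvfderiv, mfderiv_eq_fderiv] at h2
    exact h2
  filter_upwards [(chartBall (E := E) x₀ r).isOpen.mem_nhds
    ⟨mem_extChartAt_source x₀, Metric.mem_ball_self hr⟩] with y hy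
  have := hconst _ hy.2
  rwa [(extChartAt 𝓘(ℝ, E) x₀).left_inv hy.1, extChartAt_to_inv] at this

/-- The Poincaré lemma for 1-forms on a manifold. -/
lemma exists_local_primitive [FiniteDimensional ℝ E]
    (η : ∀ x : M, TangentSpace 𝓘(ℝ, E) x →ₗ[ℝ] ℂ) {W : Opens M} (hx : x₀ ∈ W)
    (hW : W ≤ chartDomain E x₀)
    (hη : ∀ v, ContMDiffOn 𝓘(ℝ, E) 𝓘(ℝ, ℂ) ∞ (fun x => η x (coordField E x₀ v x)) W)
    (hclosed : ∀ v w, ∀ x ∈ W,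
      mvfderiv 𝓘(ℝ, E) (fun y => η y (coordField E x₀ w y)) x (coordField E x₀ v x)
        = mvfderiv 𝓘(ℝ, E) (fun y => η y (coordField E x₀ v y)) x (coordField E x₀ w x)) :
    ∃ (W' : Opens M) (h : M → ℂ), x₀ ∈ W' ∧ W' ≤ W ∧ ContMDiffOn 𝓘(ℝ, E) 𝓘(ℝ, ℂ) ∞ h W' ∧
      ∀ x ∈ W', ∀ v, mvfderiv 𝓘(ℝ, E) h x v = η x v := by
  have : CompleteSpace E := FiniteDimensional.complete ℝ E
  obtain ⟨r, hr, hball, hrW⟩ := exists_chart_ball (E := E) hx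
  set φ := extChartAt 𝓘(ℝ, E) x₀ with hφ
  set B := Metric.ball (φ x₀) r with hB
  have hBo : IsOpen B := Metric.isOpen_ball
  have hsm := (contMDiffOn_extChartAt_symm (I := 𝓘(ℝ, E)) (n := ∞) x₀).mono hball
  -- The form η in coordinates, as a function to the dual of `E`; finite dimension makes each linear
  -- form continuous. `A` below is the same function on the chart ball.
  let C : M → (E →L[ℝ] ℂ) := fun x => LinearMap.toContinuousLinearMap
    { toFun := fun v => η x (coordField E x₀ v x)
      map_add' := fun v w => by
        rw [← map_add]
        exact congrArg _ (map_add ((mfderiv 𝓘(ℝ, E) 𝓘(ℝ, E) φ x).inverse) v w)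
      map_smul' := fun a v => by
        rw [RingHom.id_apply, ← map_smul]
        exact congrArg _ (map_smul ((mfderiv 𝓘(ℝ, E) 𝓘(ℝ, E) φ x).inverse) a v) }
  have hC : ∀ x v, C x v = η x (coordField E x₀ v x) := fun _ _ => rfl
  let A : E → (E →L[ℝ] ℂ) := fun e => C (φ.symm e)
  have hA : ContDiffOn ℝ ∞ A B := contDiffOn_clm_apply.2 fun v =>
    contMDiffOn_iff_contDiffOn.1 ((hη v).comp hsm hrW)
  -- The derivative of `A` in directions `v`, `w` is `X_v(η(X_w))`, so closedness of η says exactly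
  -- that the derivative of `A` is symmetric, as the Poincaré lemma on a ball requires.
  have hderiv : ∀ e ∈ B, ∀ v w, fderiv ℝ A e v w
      = mvfderiv 𝓘(ℝ, E) (fun y => η y (coordField E x₀ w y)) (φ.symm e)
        (coordField E x₀ v (φ.symm e)) := by
    intro e he v w
    have hAe : DifferentiableAt ℝ A e :=
      (hA.differentiableOn (by simp)).differentiableAt (hBo.mem_nhds he)
    have hAw : DifferentiableAt ℝ (fun e => A e w) e := hAe.clm_apply (differentiableAt_const w)
    have h1 : fderiv ℝ A e v w = fderiv ℝ (fun e => A e w) e v := by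
      rw [fderiv_clm_apply hAe (differentiableAt_const w)]
      simp
    set x := φ.symm e with hxe
    have hxs : x ∈ chartDomain E x₀ := hW (hrW e he)
    have hφx : φ x = e := φ.right_inv (hball he)
    have hev : (fun y => η y (coordField E x₀ w y)) =ᶠ[𝓝 x] fun y => A (φ y) w := by
      filter_upwards [(chartDomain E x₀).isOpen.mem_nhds hxs] with y hy
      have : φ.symm (φ y) = y := φ.left_inv (by rwa [hφ, extChartAt_source])
      change C y w = C (φ.symm (φ y)) w
      rw [this]
    have h2 : mvfderiv 𝓘(ℝ, E) (fun y => η y (coordField E x₀ w y)) x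
        = mvfderiv 𝓘(ℝ, E) (fun y => A (φ y) w) x := by
      ext u
      exact congrArg (fun l : E →L[ℝ] ℂ => l u) hev.mfderiv_eq
    have hAw' : MDifferentiableAt 𝓘(ℝ, E) 𝓘(ℝ, ℂ) (fun e => A e w) (φ x) := by
      rw [hφx]
      exact hAw.mdifferentiableAt
    rw [h1, h2, mvfderiv_comp_mfderiv (g := fun e => A e w) hAw'
      ((contMDiffAt_chart x₀ hxs).mdifferentiableAt (by simp)), mfderiv_chart_coordField hxs,
      mvfderiv, mfderiv_eq_fderiv, hφx]
    rfl
  obtain ⟨g, hg⟩ := (convex_ball (φ x₀) r).exists_forall_hasFDerivAt_of_fderiv_symmetric hBo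
    (hA.differentiableOn (by simp)) fun e he v w => by
      rw [hderiv e he, hderiv e he, hclosed v w _ (hrW e he)]
  have hgsm : ContDiffOn ℝ ∞ g B := (contDiffOn_infty_iff_fderiv_of_isOpen hBo).2
    ⟨fun e he => (hg e he).differentiableAt.differentiableWithinAt,
      hA.congr fun e he => (hg e he).fderiv⟩
  have hmem : ∀ y ∈ chartBall (E := E) x₀ r, y ∈ chartDomain E x₀ := fun y hy => by
    have := hy.1
    rwa [extChartAt_source] at this
  refine ⟨chartBall (E := E) x₀ r, fun y => g (φ y), ⟨mem_extChartAt_source x₀, Metric.mem_ball_self hr⟩,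
    fun y hy => ?_, ?_, fun y hy v => ?_⟩
  · have := hrW _ hy.2
    rwa [φ.left_inv hy.1] at this
  · exact (contMDiffOn_iff_contDiffOn.2 hgsm).comp
      (fun y hy => (contMDiffAt_chart x₀ (hmem y hy)).contMDiffWithinAt) fun y hy => hy.2
  · have hgd := hg _ hy.2
    rw [mvfderiv_comp_mfderiv (g := g) hgd.differentiableAt.mdifferentiableAt
      ((contMDiffAt_chart x₀ (hmem y hy)).mdifferentiableAt (by simp)), mvfderiv,
      mfderiv_eq_fderiv, hgd.fderiv]
    have hy' : A (φ y) = C y := congrArg C (φ.left_inv hy.1)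
    change A (φ y) _ = _
    rw [hy']
    refine (hC y _).trans (congrArg (η y) ?_)
    exact (isInvertible_mfderiv_chart (hmem y hy)).inverse_apply_self v

end Chart

/-! ### Existence of frames and local frames with a pulled-back connection form -/

section LineBundle

variable {E : Type*} [NormedAddCommGroup E] [NormedSpace ℝ E]
  {M : Type u} [TopologicalSpace M] [ChartedSpace E M]
  [IsManifold 𝓘(ℝ, E) ∞ M]

variable {L : M → Type v} [TopologicalSpace (TotalSpace ℂ L)]
  [∀ x, AddCommGroup (L x)] [∀ x, Module ℂ (L x)] [∀ x, TopologicalSpace (L x)]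
  [∀ x, IsTopologicalAddGroup (L x)] [∀ x, ContinuousSMul ℝ (L x)]
  [FiberBundle ℂ L] [VectorBundle ℝ ℂ L] [VectorBundle ℂ ℂ L]
  {Ω : SymplecticForm E M}

/-- The local connection form `θ` of a section as a linear form. -/
def thetaLinear (Q : PrequantumStructure L Ω) (s : ∀ x : M, L x) (x : M) :
    TangentSpace 𝓘(ℝ, E) x →ₗ[ℝ] ℂ where
  toFun := theta Q s x
  map_add' v w := by rw [theta, map_add, smul_add, quot_add, theta, theta]
  map_smul' r v := by
    rw [theta, map_smul, ← Complex.coe_smul r (Q.conn s x v), smul_comm, quot_smul_left, theta,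
      RingHom.id_apply, Complex.real_smul]

lemma smoothField_mono {X : ∀ x : M, TangentSpace 𝓘(ℝ, E) x} {U V : Opens M}
    (h : SmoothField X U) (hVU : V ≤ U) : SmoothField X V := ContMDiffOn.mono h hVU

section Frame

variable [ContMDiffVectorBundle ∞ ℂ L 𝓘(ℝ, E)]

variable (E L) in
/-- Trivialization covers exist. -/
lemma exists_trivializations : ∃ 𝒰 : Cech.OpenCover M, Nonempty (Trivializations E L 𝒰) := by
  let 𝒰 : Cech.OpenCover M :=
    { ι := M
      U := fun x => ⟨(trivializationAt ℂ L x).baseSet, (trivializationAt ℂ L x).open_baseSet⟩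
      covers := fun x => ⟨x, mem_baseSet_trivializationAt ℂ L x⟩ }
  have key : ∀ x y, y ∈ (trivializationAt ℂ L x).baseSet →
      (trivializationAt ℂ L x ⟨y, (trivializationAt ℂ L x).symm y 1⟩).2 = 1 := fun x y hy => by
    rw [(trivializationAt ℂ L x).apply_mk_symm hy]
  refine ⟨𝒰, ⟨⟨fun x y => (trivializationAt ℂ L x).symm y 1, fun x => ?_, fun x y hy h => ?_⟩⟩⟩
  · refine ((trivializationAt ℂ L x).contMDiffOn_section_baseSet_iff).2 ?_
    exact (contMDiffOn_const (c := (1 : ℂ))).congr fun y hy => key x y hy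
  · have h1 := key x y hy
    rw [h] at h1
    have h2 := ((trivializationAt ℂ L x).linear ℂ hy).map_smul 0 0
    rw [zero_smul, zero_smul, h1] at h2
    exact one_ne_zero h2

end Frame

variable [FiniteDimensional ℝ E] [ContMDiffVectorBundle ∞ ℂ L 𝓘(ℝ, E)]

/-- Near every point of `Φ⁻¹(U)`, there is a frame of `L` with connection form `Φ^*θ`, where `θ` is
the connection form of a frame `s` over `U`. -/
lemma exists_local_frame (Q : PrequantumStructure L Ω) {Φ : M ≃ₘ⟮𝓘(ℝ, E), 𝓘(ℝ, E)⟯ M}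
    (hΦ : IsSymplectomorphism Ω Φ) {U : Opens M} {s : ∀ x : M, L x} (hs : SmoothSection E s U)
    (h0 : ∀ x ∈ U, s x ≠ 0) {x₀ : M} (hx₀ : Φ x₀ ∈ U) :
    ∃ (W : Opens M) (t : ∀ x : M, L x), x₀ ∈ W ∧ W ≤ Opens.comap (toCont Φ) U ∧
      SmoothSection E t W ∧ (∀ x ∈ W, t x ≠ 0) ∧ ∀ x ∈ W, ∀ v : TangentSpace 𝓘(ℝ, E) x,
        theta Q t x v = theta Q s (Φ x) (mfderiv 𝓘(ℝ, E) 𝓘(ℝ, E) Φ x v) := by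
  have : CompleteSpace E := FiniteDimensional.complete ℝ E
  obtain ⟨𝒰, ⟨S⟩⟩ := exists_trivializations E L (M := M)
  obtain ⟨k, hk⟩ := 𝒰.covers x₀
  set s₀ := S.s k with hs₀
  -- The difference `Φ^*θ - θ₀` with the form `θ₀` of an arbitrary frame near `x₀`; a primitive of
  -- it is the logarithm, up to `i`, of the required gauge factor.
  let η : ∀ x : M, TangentSpace 𝓘(ℝ, E) x →ₗ[ℝ] ℂ := fun x =>
    thetaLinear Q s (Φ x) ∘ₗ (mfderiv 𝓘(ℝ, E) 𝓘(ℝ, E) Φ x).toLinearMap - thetaLinear Q s₀ x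
  let W : Opens M := Opens.comap (toCont Φ) U ⊓ 𝒰.U k ⊓ chartDomain E x₀
  have hWU : W ≤ Opens.comap (toCont Φ) U := inf_le_left.trans inf_le_left
  have hWk : W ≤ 𝒰.U k := inf_le_left.trans inf_le_right
  have hWc : W ≤ chartDomain E x₀ := inf_le_right
  let X (v : E) : ∀ x : M, TangentSpace 𝓘(ℝ, E) x := coordField E x₀ v
  -- Push-forwards of the coordinate fields. They again commute, so the curvature identity for `s`
  -- can be applied to them at `Φ x`.
  let X' (v : E) : ∀ x : M, TangentSpace 𝓘(ℝ, E) x :=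
    VectorField.mpullback 𝓘(ℝ, E) 𝓘(ℝ, E) Φ.symm (X v)
  let V : Opens M := Opens.comap (toCont Φ.symm) W
  have hV : ∀ x ∈ W, Φ x ∈ V := fun x hx => by
    change Φ.symm (Φ x) ∈ W
    rwa [Φ.symm_apply_apply]
  have hVU : V ≤ U := fun y hy => by
    have : Φ (Φ.symm y) ∈ U := hWU hy
    rwa [Φ.apply_symm_apply] at this
  have hX : ∀ v, SmoothField (X v) W := fun v => smoothField_mono (smoothField_coordField v) hWc
  have hX' : ∀ v, SmoothField (X' v) V := fun v => (hX v).mpullback_diffeo Φ.symm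
  have hΦX : ∀ v x, mfderiv 𝓘(ℝ, E) 𝓘(ℝ, E) Φ x (X v x) = X' v (Φ x) := fun v x => by
    rw [← mfderiv_mpullback_diffeo Φ (X' v), mpullback_mpullback_symm]
  have hbr' : ∀ v w, ∀ x ∈ W,
      VectorField.mlieBracket 𝓘(ℝ, E) (X' v) (X' w) (Φ x) = 0 := fun v w x hx => by
    rw [mlieBracket_mpullback (Φ.symm.contMDiff (Φ x)) (V := W) (hV x hx) (hX v) (hX w),
      VectorField.mpullback_apply]
    exact (congrArg _ (mlieBracket_coordField (hWc (hV x hx)) v w)).trans (map_zero _)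
  have hsV := hs.mono hVU
  have h0V : ∀ x ∈ V, s x ≠ 0 := fun x hx => h0 x (hVU hx)
  have hs₀W : SmoothSection E s₀ W := (S.smooth k).mono hWk
  have h0W : ∀ x ∈ W, s₀ x ≠ 0 := fun x hx => S.ne_zero k x (hWk hx)
  have hF := fun v => contMDiffOn_theta Q hsV h0V (hX' v)
  have hG := fun v => contMDiffOn_theta Q hs₀W h0W (hX v)
  have hηX : ∀ v, (fun x => η x (X v x))
      = fun x => theta Q s (Φ x) (X' v (Φ x)) - theta Q s₀ x (X v x) := fun v => by
    funext x
    rw [← hΦX]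
    rfl
  have hFΦ : ∀ v, ContMDiffOn 𝓘(ℝ, E) 𝓘(ℝ, ℂ) ∞
      (fun x => theta Q s (Φ x) (X' v (Φ x))) W := fun v =>
    (hF v).comp Φ.contMDiff.contMDiffOn hV
  have hd : ∀ v w, ∀ x ∈ W, mvfderiv 𝓘(ℝ, E) (fun y => η y (X w y)) x (X v x)
      = mvfderiv 𝓘(ℝ, E) (fun y => theta Q s y (X' w y)) (Φ x) (X' v (Φ x))
        - mvfderiv 𝓘(ℝ, E) (fun y => theta Q s₀ y (X w y)) x (X v x) := fun v w x hx => by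
    have h1 := mvfderiv_sub (mdifferentiableAt_of_contMDiffOn (hFΦ w) hx)
      (mdifferentiableAt_of_contMDiffOn (hG w) hx)
    have h2 := mvfderiv_comp_mfderiv (mdifferentiableAt_of_contMDiffOn (hF w) (hV x hx))
      (Φ.mdifferentiable (by simp) x) (X v x)
    rw [hΦX] at h2
    rw [hηX, ← h2]
    exact congrArg (fun l : TangentSpace 𝓘(ℝ, E) x →L[ℝ] ℂ => l (X v x)) h1
  obtain ⟨W', h, hxW', hW'W, hh, hdh⟩ := exists_local_primitive η (W := W)
    ⟨⟨hx₀, hk⟩, mem_chart_source E x₀⟩ hWc (fun v => by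
      change ContMDiffOn _ _ _ (fun x => η x (X v x)) _
      rw [hηX]
      exact (hFΦ v).sub (hG v)) (fun v w x hx => by
      -- `c1` gives `dθ = Ω` at `Φ x` and `c2` gives `dθ₀ = Ω` at `x`; since Φ preserves Ω, the
      -- right-hand sides agree and η is closed.
      have c1 := mvfderiv_theta_sub Q hsV h0V (hX' v) (hX' w) (hV x hx) (hbr' v w x hx)
      have c2 := mvfderiv_theta_sub Q hs₀W h0W (hX v) (hX w) hx (mlieBracket_coordField (hWc hx) v w)
      rw [← hΦX, ← hΦX, hΦ, hΦX, hΦX] at c1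
      refine (hd v w x hx).trans (Eq.trans ?_ (hd w v x hx).symm)
      linear_combination c1 - c2)
  -- With `dh = η`, the gauge law adds `-i (i dh) = η` to `θ₀`, which yields `Φ^*θ`.
  have hexp : ContMDiffOn 𝓘(ℝ, E) 𝓘(ℝ, ℂ) ∞ (fun x => Complex.exp (Complex.I * h x)) W' :=
    (Complex.contDiff_exp.comp (contDiff_const.mul contDiff_id)).contMDiff.comp_contMDiffOn hh
  have hs₀' := hs₀W.mono hW'W
  refine ⟨W', fun x => Complex.exp (Complex.I * h x) • s₀ x, hxW', hW'W.trans hWU,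
    SmoothSection.smul hexp hs₀', fun x hx => smul_ne_zero (Complex.exp_ne_zero _)
      (h0W x (hW'W hx)), fun x hx v => ?_⟩
  have hder : mvfderiv 𝓘(ℝ, E) (fun x => Complex.exp (Complex.I * h x)) x v
      = Complex.exp (Complex.I * h x) * (Complex.I * mvfderiv 𝓘(ℝ, E) h x v) := by
    have hH : HasFDerivAt (𝕜 := ℝ) (fun z : ℂ => Complex.exp (Complex.I * z))
        ((ContinuousLinearMap.mul ℝ ℂ (Complex.exp (Complex.I * h x) * Complex.I))) (h x) := by
      have h1 : HasDerivAt (fun z : ℂ => Complex.exp (Complex.I * z))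
          (Complex.exp (Complex.I * h x) * (Complex.I * 1)) (h x) :=
        ((hasDerivAt_id (h x)).const_mul Complex.I).cexp
      convert! h1.hasFDerivAt.restrictScalars ℝ using 1
      ext z
      simp [mul_comm]
    have h3 := mvfderiv_comp_mfderiv hH.differentiableAt.mdifferentiableAt
      (mdifferentiableAt_of_contMDiffOn hh hx) v
    refine h3.trans ?_
    rw [mvfderiv, mfderiv_eq_fderiv, hH.fderiv]
    exact mul_assoc _ _ _
  rw [theta_smul_section Q hexp hs₀' hx (Complex.exp_ne_zero _) (h0W x (hW'W hx)), hder, hdh x hx,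
    mul_div_cancel_left₀ _ (Complex.exp_ne_zero _), ← mul_assoc, Complex.I_mul_I]
  change theta Q s₀ x v - -1 * (theta Q s (Φ x) (mfderiv 𝓘(ℝ, E) 𝓘(ℝ, E) Φ x v)
    - theta Q s₀ x v) = _
  ring

end LineBundle

end Prequantum

/-! ### Trivializing locally constant cocycles -/

namespace Cech

universe u

variable {X : Type u} [TopologicalSpace X]

/-- The value at `x` of a section of the constant sheaf `ℂˣ`. -/
def constUnitsEval {U : Opens X} (a : (constUnits X).obj (op U)) (x : U) : ℂˣ :=
  (Additive.toMul (show Additive (LocallyConstant U ℂˣ) from a)) x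

lemma constUnits_ext {U : Opens X} {a b : (constUnits X).obj (op U)}
    (h : ∀ x, constUnitsEval a x = constUnitsEval b x) : a = b :=
  LocallyConstant.ext (f := (Additive.toMul (show Additive (LocallyConstant U ℂˣ) from a)))
    (g := (Additive.toMul (show Additive (LocallyConstant U ℂˣ) from b))) h

lemma constUnitsEval_add {U : Opens X} (a b : (constUnits X).obj (op U)) (x : U) :
    constUnitsEval (a + b) x = constUnitsEval a x * constUnitsEval b x := rfl

lemma constUnitsEval_sub {U : Opens X} (a b : (constUnits X).obj (op U)) (x : U) :
    constUnitsEval (a - b) x = constUnitsEval a x / constUnitsEval b x := rfl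

lemma constUnitsEval_res {U V : Opens X} (h : U ≤ V) (a : (constUnits X).obj (op V)) (x : U) :
    constUnitsEval (res (constUnits X) h a) x = constUnitsEval a ⟨x, h x.2⟩ := rfl

lemma isLocallyConstant_constUnitsEval {U : Opens X} (a : (constUnits X).obj (op U)) :
    IsLocallyConstant (constUnitsEval a) :=
  (Additive.toMul (show Additive (LocallyConstant U ℂˣ) from a)).isLocallyConstant

/-- The section of the constant sheaf `ℂˣ` given by a locally constant function. -/
def constUnitsMk {U : Opens X} (f : U → ℂˣ) (hf : IsLocallyConstant f) :
    (constUnits X).obj (op U) :=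
  (show Additive (LocallyConstant U ℂˣ) from Additive.ofMul ⟨f, hf⟩)

/-- If `Ȟ¹(X, ℂˣ) = 0`, locally constant transition functions satisfying the cocycle identity are
locally constantly trivial on a refinement. -/
lemma exists_locallyConstant_trivialization [Subsingleton (H (constUnits X) 1)] (𝒲 : OpenCover X)
    (ρ : 𝒲.ι → 𝒲.ι → X → ℂ) (hne : ∀ k l, ∀ x ∈ 𝒲.U k, x ∈ 𝒲.U l → ρ k l x ≠ 0)
    (hloc : ∀ k l, ∀ x ∈ 𝒲.U k, x ∈ 𝒲.U l → ∀ᶠ y in 𝓝 x, ρ k l y = ρ k l x)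
    (hmul : ∀ k l m, ∀ x ∈ 𝒲.U k, x ∈ 𝒲.U l → x ∈ 𝒲.U m → ρ k l x * ρ l m x = ρ k m x) :
    ∃ (𝒱 : OpenCover X) (r : OpenCover.Refinement 𝒱 𝒲) (b : 𝒱.ι → X → ℂ),
      (∀ k x, b k x ≠ 0) ∧ (∀ k, ∀ x ∈ 𝒱.U k, ∀ᶠ y in 𝓝 x, b k y = b k x) ∧
      ∀ k l, ∀ x ∈ 𝒱.U k, x ∈ 𝒱.U l → b k x * ρ (r.φ k) (r.φ l) x = b l x := by
  classical
  have hA : ∀ (A : Fin 2 → 𝒲.ι) (x : 𝒲.inter A) (j : Fin 2), (x : X) ∈ 𝒲.U (A j) :=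
    fun A x j => (𝒲.mem_inter A x).1 x.2 j
  let c : Cochain (constUnits X) 𝒲 1 := fun A => constUnitsMk
    (fun x => Units.mk0 (ρ (A 0) (A 1) x) (hne _ _ _ (hA A x 0) (hA A x 1)))
    ((IsLocallyConstant.iff_eventually_eq _).2 fun x => by
      filter_upwards [continuous_subtype_val.continuousAt.eventually
        (hloc _ _ _ (hA A x 0) (hA A x 1))] with y hy
      exact Units.ext hy)
  have hc : c ∈ cocycles (constUnits X) 𝒲 1 := by
    refine LinearMap.mem_ker.2 (funext fun A => constUnits_ext fun x => Units.ext ?_)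
    have hx := fun j => (𝒲.mem_inter A x).1 x.2 j
    rw [d_one_apply, constUnitsEval_add, constUnitsEval_sub, constUnitsEval_res,
      constUnitsEval_res, constUnitsEval_res]
    -- The differential written multiplicatively: the alternating sum of the three faces becomes
    -- this product and quotient.
    change ρ (A 1) (A 2) x / ρ (A 0) (A 2) x * ρ (A 0) (A 1) x = 1
    rw [← hmul _ _ _ _ (hx 0) (hx 1) (hx 2)]
    have h1 := hne _ _ _ (hx 0) (hx 1)
    have h2 := hne _ _ _ (hx 1) (hx 2)
    field_simp
  obtain ⟨𝒱, r, b, hb⟩ := exists_refinement_coboundary (constUnits X) ⟨c, hc⟩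
  have hmem : ∀ {k x}, x ∈ 𝒱.U k → x ∈ 𝒱.inter (fun _ : Fin 1 => k) := fun {k x} hx =>
    (𝒱.mem_inter _ x).2 fun _ => hx
  -- The default value 1 off the open set makes `β` nonvanishing everywhere, as the conclusion
  -- demands.
  let β : 𝒱.ι → X → ℂ := fun k x =>
    if h : x ∈ 𝒱.inter (fun _ : Fin 1 => k) then (constUnitsEval (b fun _ => k) ⟨x, h⟩ : ℂ) else 1
  have hβ : ∀ (B : Fin 1 → 𝒱.ι) (x : 𝒱.inter B), (constUnitsEval (b B) x : ℂ) = β (B 0) x := by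
    intro B x
    obtain ⟨k, rfl⟩ : ∃ k, B = fun _ => k := ⟨B 0, funext fun j => by rw [Subsingleton.elim j 0]⟩
    simp only [β]
    rw [dif_pos x.2]
  refine ⟨𝒱, r, β, fun k x => ?_, fun k x hx => ?_, fun k l x hk hl => ?_⟩
  · simp only [β]
    split_ifs
    exacts [Units.ne_zero _, one_ne_zero]
  · have h1 := (IsLocallyConstant.iff_eventually_eq _).1
      (isLocallyConstant_constUnitsEval (b fun _ => k)) ⟨x, hmem hx⟩
    rw [(𝒱.inter fun _ : Fin 1 => k).isOpen.isOpenEmbedding_subtypeVal.map_nhds_eq ⟨x, hmem hx⟩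
      |>.symm, Filter.eventually_map]
    filter_upwards [h1] with y hy
    rw [← hβ (fun _ => k) y, hy]
    exact hβ (fun _ => k) ⟨x, hmem hx⟩
  · have hx : x ∈ 𝒱.inter ![k, l] := (𝒱.mem_inter _ x).2 fun j => by
      fin_cases j
      exacts [hk, hl]
    have h1 := congrArg (fun a => ((constUnitsEval a ⟨x, hx⟩ : ℂˣ) : ℂ)) (congrFun hb ![k, l])
    simp only [d_zero_apply, constUnitsEval_sub, constUnitsEval_res] at h1
    rw [Units.val_div_eq_div_val, hβ, hβ] at h1
    change β l x / β k x = ρ (r.φ k) (r.φ l) x at h1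
    have hk0 : β k x ≠ 0 := by
      rw [← hβ (fun _ => k) ⟨x, hmem hk⟩]
      exact Units.ne_zero _
    rw [← h1, mul_div_cancel₀ _ hk0]

end Cech

/-! ### Gluing local frames into a complementary trivialization cover -/

namespace Prequantum

universe u v

section LineBundle

variable {E : Type*} [NormedAddCommGroup E] [NormedSpace ℝ E]
  {M : Type u} [TopologicalSpace M] [ChartedSpace E M]
  [IsManifold 𝓘(ℝ, E) ∞ M]

variable {L : M → Type v} [TopologicalSpace (TotalSpace ℂ L)]
  [∀ x, AddCommGroup (L x)] [∀ x, Module ℂ (L x)] [∀ x, TopologicalSpace (L x)]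
  [∀ x, IsTopologicalAddGroup (L x)] [∀ x, ContinuousSMul ℝ (L x)]
  [FiberBundle ℂ L] [VectorBundle ℝ ℂ L] [VectorBundle ℂ ℂ L]
  {Ω : SymplecticForm E M}

lemma quot_mul_quot {x : M} (u : L x) {v : L x} (hv : v ≠ 0) (w : L x) :
    quot u v * quot v w = quot u w := by
  rw [← quot_smul_left, quot_smul_self u hv]

lemma theta_congr (Q : PrequantumStructure L Ω) {σ τ : ∀ x : M, L x} {U : Opens M}
    (hσ : SmoothSection E σ U) (h : ∀ x ∈ U, τ x = σ x) {x : M} (hx : x ∈ U)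
    (v : TangentSpace 𝓘(ℝ, E) x) : theta Q τ x v = theta Q σ x v := by
  rw [theta, theta, conn_congr Q hσ h hx, h x hx]

/-- Changing a frame by the pullback of a transition function changes its connection form
accordingly. -/
lemma theta_pullback_transition (Q : PrequantumStructure L Ω) {Φ : M ≃ₘ⟮𝓘(ℝ, E), 𝓘(ℝ, E)⟯ M}
    {s s' t : ∀ x : M, L x} {U W : Opens M} (hs : SmoothSection E s U)
    (hs' : SmoothSection E s' U) (h0 : ∀ x ∈ U, s x ≠ 0) (h0' : ∀ x ∈ U, s' x ≠ 0)
    (ht : SmoothSection E t W) (ht0 : ∀ x ∈ W, t x ≠ 0) (hWU : W ≤ Opens.comap (toCont Φ) U)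
    (hθ : ∀ x ∈ W, ∀ v : TangentSpace 𝓘(ℝ, E) x,
      theta Q t x v = theta Q s' (Φ x) (mfderiv 𝓘(ℝ, E) 𝓘(ℝ, E) Φ x v)) :
    SmoothSection E (fun x => quot (s (Φ x)) (s' (Φ x)) • t x) W ∧
    ∀ x ∈ W, ∀ v : TangentSpace 𝓘(ℝ, E) x,
      theta Q (fun x => quot (s (Φ x)) (s' (Φ x)) • t x) x v
        = theta Q s (Φ x) (mfderiv 𝓘(ℝ, E) 𝓘(ℝ, E) Φ x v) := by
  have hq := contMDiffOn_quot hs hs' h0'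
  have hqΦ : ContMDiffOn 𝓘(ℝ, E) 𝓘(ℝ, ℂ) ∞ (fun x => quot (s (Φ x)) (s' (Φ x))) W :=
    hq.comp Φ.contMDiff.contMDiffOn hWU
  refine ⟨SmoothSection.smul hqΦ ht, fun x hx v => ?_⟩
  have hΦx : Φ x ∈ U := hWU hx
  have hne := quot_ne_zero (h0 _ hΦx) (h0' _ hΦx)
  -- The factor contributes `-i d(q ∘ Φ)/(q ∘ Φ)` upstairs and `-i dq/q` downstairs, where `q =
  -- s/s'`; the chain rule matches them.
  rw [theta_smul_section Q hqΦ ht hx hne (ht0 x hx), hθ x hx,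
    theta_congr Q (SmoothSection.smul hq hs') (fun y hy => (quot_smul_self (s y) (h0' y hy)).symm)
      hΦx, theta_smul_section Q hq hs' hΦx hne (h0' _ hΦx),
    mvfderiv_comp_mfderiv (g := fun y => quot (s y) (s' y))
      (mdifferentiableAt_of_contMDiffOn hq hΦx) (Φ.mdifferentiable (by simp) x)]

/-- The ratio of two frames with the same connection form is locally constant. -/
lemma eventually_quot_eq (Q : PrequantumStructure L Ω) {s t : ∀ x : M, L x} {W : Opens M}
    (hs : SmoothSection E s W) (ht : SmoothSection E t W) (hs0 : ∀ x ∈ W, s x ≠ 0)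
    (ht0 : ∀ x ∈ W, t x ≠ 0) (h : ∀ x ∈ W, ∀ v, theta Q s x v = theta Q t x v) {x : M}
    (hx : x ∈ W) : ∀ᶠ y in 𝓝 x, quot (s y) (t y) = quot (s x) (t x) := by
  have hq := contMDiffOn_quot hs ht ht0
  refine eventually_eq_of_mvfderiv_eq_zero hq (fun y hy v => ?_) hx
  have hne := quot_ne_zero (hs0 _ hy) (ht0 _ hy)
  have h1 := h y hy v
  -- Writing `s = (s/t) t`, the gauge law turns equality of the two forms into vanishing of
  -- `d(s/t)/(s/t)`.
  rw [theta_congr Q (SmoothSection.smul hq ht)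
    (fun z hz => (quot_smul_self (s z) (ht0 z hz)).symm) hy,
    theta_smul_section Q hq ht hy hne (ht0 y hy), sub_eq_self, mul_eq_zero, div_eq_zero_iff] at h1
  exact (h1.resolve_left Complex.I_ne_zero).resolve_right hne

lemma contMDiffOn_of_eventually_eq {f : M → ℂ} {U : Opens M}
    (h : ∀ x ∈ U, ∀ᶠ y in 𝓝 x, f y = f x) : ContMDiffOn 𝓘(ℝ, E) 𝓘(ℝ, ℂ) ∞ f U := fun x hx =>
  ((contMDiffAt_const (c := f x)).congr_of_eventuallyEq (h x hx)).contMDiffWithinAt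

lemma mvfderiv_eq_zero_of_eventually_eq {f : M → ℂ} {x : M} (h : ∀ᶠ y in 𝓝 x, f y = f x)
    (v : TangentSpace 𝓘(ℝ, E) x) : mvfderiv 𝓘(ℝ, E) f x v = 0 := by
  have h1 : f =ᶠ[𝓝 x] fun _ => f x := h
  have h2 := h1.mfderiv_eq (I := 𝓘(ℝ, E)) (I' := 𝓘(ℝ, ℂ))
  rw [mfderiv_const] at h2
  exact congrArg (fun l : E →L[ℝ] ℂ => l v) h2

variable [FiniteDimensional ℝ E] [ContMDiffVectorBundle ∞ ℂ L 𝓘(ℝ, E)]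

/-- If `Ȟ¹(M, ℂˣ) = 0`, every trivialization cover has a complementary one. -/
lemma exists_isComplementary (Q : PrequantumStructure L Ω) {Φ : M ≃ₘ⟮𝓘(ℝ, E), 𝓘(ℝ, E)⟯ M}
    (hΦ : IsSymplectomorphism Ω Φ) [Subsingleton (Cech.H (Cech.constUnits M) 1)]
    {𝒰 : Cech.OpenCover M} (S : Trivializations E L 𝒰) : ∃ T, IsComplementary Q Φ S T := by
  choose α hα using fun x => 𝒰.covers (Φ x)
  choose W t hxW hWU ht ht0 hθ using fun x =>
    exists_local_frame Q hΦ (S.smooth (α x)) (S.ne_zero (α x)) (hα x)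
  let 𝒲 : Cech.OpenCover M := ⟨M, W, fun x => ⟨x, hxW x⟩⟩
  let μ (a b : 𝒰.ι) (x : M) : ℂ := quot (S.s a (Φ x)) (S.s b (Φ x))
  have hμ : ∀ a b c x, Φ x ∈ 𝒰.U b → μ a b x * μ b c x = μ a c x :=
    fun a b c x hb => quot_mul_quot _ (S.ne_zero b _ hb) _
  have hμ0 : ∀ a b x, Φ x ∈ 𝒰.U a → Φ x ∈ 𝒰.U b → μ a b x ≠ 0 :=
    fun a b x ha hb => quot_ne_zero (S.ne_zero a _ ha) (S.ne_zero b _ hb)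
  have hchange : ∀ (a b : 𝒰.ι) {V : Opens M} {τ : ∀ x : M, L x}, SmoothSection E τ V →
      (∀ x ∈ V, τ x ≠ 0) → V ≤ Opens.comap (toCont Φ) (𝒰.U a) →
      V ≤ Opens.comap (toCont Φ) (𝒰.U b) →
      (∀ x ∈ V, ∀ v : TangentSpace 𝓘(ℝ, E) x,
        theta Q τ x v = theta Q (S.s b) (Φ x) (mfderiv 𝓘(ℝ, E) 𝓘(ℝ, E) Φ x v)) →
      SmoothSection E (fun x => μ a b x • τ x) V ∧ ∀ x ∈ V, ∀ v : TangentSpace 𝓘(ℝ, E) x,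
        theta Q (fun x => μ a b x • τ x) x v
          = theta Q (S.s a) (Φ x) (mfderiv 𝓘(ℝ, E) 𝓘(ℝ, E) Φ x v) :=
    fun a b V τ hτ hτ0 hVa hVb h =>
      theta_pullback_transition Q ((S.smooth a).mono inf_le_left) ((S.smooth b).mono inf_le_right)
        (fun x hx => S.ne_zero a x hx.1) (fun x hx => S.ne_zero b x hx.2) hτ hτ0
        (U := 𝒰.U a ⊓ 𝒰.U b) (fun x hx => ⟨hVa hx, hVb hx⟩) h
  have hW : ∀ k x, x ∈ W k → Φ x ∈ 𝒰.U (α k) := fun k x hx => hWU k hx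
  -- Numerator and denominator both have connection form `Φ^*θ` for the index `α k`, so `ρ` is
  -- locally constant on overlaps. It measures how far the frames `t` are from having transition
  -- functions `μ`, that is, `λ ∘ Φ`.
  let ρ (k l : M) (x : M) : ℂ := quot (t k x) (μ (α k) (α l) x • t l x)
  have hμt : ∀ k l x, x ∈ W k → x ∈ W l → μ (α k) (α l) x • t l x ≠ 0 := fun k l x hk hl =>
    smul_ne_zero (hμ0 _ _ _ (hW k x hk) (hW l x hl)) (ht0 l x hl)
  have hρ : ∀ k l x, x ∈ W k → x ∈ W l → (ρ k l x * μ (α k) (α l) x) • t l x = t k x :=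
    fun k l x hk hl => by rw [mul_smul, quot_smul_self _ (hμt k l x hk hl)]
  obtain ⟨𝒱, r, b, hb0, hbloc, hb⟩ := Cech.exists_locallyConstant_trivialization 𝒲 ρ
    (fun k l x hk hl => quot_ne_zero (ht0 k x hk) (hμt k l x hk hl))
    (fun k l x hk hl => by
      have hk' := (ht k).mono (inf_le_left : W k ⊓ W l ≤ W k)
      have hl' := (ht l).mono (inf_le_right : W k ⊓ W l ≤ W l)
      have h1 := hchange (α k) (α l) hl' (fun x hx => ht0 l x hx.2) (fun x hx => hW k x hx.1)
        (fun x hx => hW l x hx.2) (fun x hx => hθ l x hx.2)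
      exact eventually_quot_eq Q hk' h1.1 (fun x hx => ht0 k x hx.1)
        (fun x hx => hμt k l x hx.1 hx.2)
        (fun x hx v => by rw [h1.2 x hx, hθ k x hx.1]) ⟨hk, hl⟩)
    (fun k l m x hk hl hm => by
      have h1 : (ρ k l x * ρ l m x * μ (α k) (α m) x) • t m x
          = (ρ k m x * μ (α k) (α m) x) • t m x := by
        rw [hρ k m x hk hm, ← hρ k l x hk hl, ← hρ l m x hl hm, smul_smul,
          ← hμ (α k) (α l) (α m) x (hW l x hl)]
        congr 1
        ring
      exact mul_right_cancel₀ (hμ0 _ _ _ (hW k x hk) (hW m x hm))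
        (smul_fiber_right_injective (ht0 m x hm) h1))
  let a (k : 𝒱.ι) : 𝒰.ι := α (r.φ k)
  -- The identity `b k * ρ = b l` absorbs the defect, so the `τ k` have transition functions exactly
  -- `μ`, while locally constant factors leave the connection forms alone.
  let τ (k : 𝒱.ι) (x : M) : L x := b k x • t (r.φ k) x
  have hVW : ∀ k, 𝒱.U k ≤ W (r.φ k) := r.le
  have hVU : ∀ k x, x ∈ 𝒱.U k → Φ x ∈ 𝒰.U (a k) := fun k x hx => hW _ x (hVW k hx)
  have hbs := fun k => contMDiffOn_of_eventually_eq (E := E) (hbloc k)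
  have hτ : ∀ k, SmoothSection E (τ k) (𝒱.U k) := fun k =>
    SmoothSection.smul (hbs k) ((ht _).mono (hVW k))
  have hτ0 : ∀ k, ∀ x ∈ 𝒱.U k, τ k x ≠ 0 := fun k x hx =>
    smul_ne_zero (hb0 k x) (ht0 _ x (hVW k hx))
  have hτθ : ∀ k, ∀ x ∈ 𝒱.U k, ∀ v : TangentSpace 𝓘(ℝ, E) x,
      theta Q (τ k) x v = theta Q (S.s (a k)) (Φ x) (mfderiv 𝓘(ℝ, E) 𝓘(ℝ, E) Φ x v) :=
    fun k x hx v => by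
      rw [theta_smul_section Q (hbs k) ((ht _).mono (hVW k)) hx (hb0 k x) (ht0 _ x (hVW k hx)),
        hθ _ x (hVW k hx), mvfderiv_eq_zero_of_eventually_eq (hbloc k x hx)]
      simp [a]
  have hττ : ∀ k l x, x ∈ 𝒱.U k → x ∈ 𝒱.U l → τ k x = μ (a k) (a l) x • τ l x :=
    fun k l x hk hl => by
      simp only [τ]
      rw [← hρ _ _ x (hVW k hk) (hVW l hl), smul_smul, smul_smul, ← mul_assoc, hb k l x hk hl,
        mul_comm]
  choose κ hκ using 𝒱.covers
  -- Defined pointwise through an arbitrary member of `𝒱` containing `x`; the exact transition law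
  -- of `τ` makes the choice irrelevant, so near each point one index `k` may be fixed to check
  -- smoothness and the connection form.
  let T (i : 𝒰.ι) (x : M) : L x := μ i (a (κ x)) x • τ (κ x) x
  have hT : ∀ i k x, Φ x ∈ 𝒰.U i → x ∈ 𝒱.U k → T i x = μ i (a k) x • τ k x :=
    fun i k x hi hk => by
      simp only [T]
      rw [hττ (κ x) k x (hκ x) hk, smul_smul, hμ _ _ _ _ (hVU _ x (hκ x))]
  have hTloc : ∀ i k, SmoothSection E (T i) (Opens.comap (toCont Φ) (𝒰.U i) ⊓ 𝒱.U k) ∧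
      ∀ x ∈ Opens.comap (toCont Φ) (𝒰.U i) ⊓ 𝒱.U k, ∀ v : TangentSpace 𝓘(ℝ, E) x,
        theta Q (T i) x v = theta Q (S.s i) (Φ x) (mfderiv 𝓘(ℝ, E) 𝓘(ℝ, E) Φ x v) :=
    fun i k => by
      have h1 := hchange i (a k) (V := Opens.comap (toCont Φ) (𝒰.U i) ⊓ 𝒱.U k)
        ((hτ k).mono inf_le_right) (fun x hx => hτ0 k x hx.2) inf_le_left
        (fun x hx => hVU k x hx.2) (fun x hx => hτθ k x hx.2)
      have h2 : ∀ x ∈ Opens.comap (toCont Φ) (𝒰.U i) ⊓ 𝒱.U k, T i x = μ i (a k) x • τ k x :=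
        fun x hx => hT i k x hx.1 hx.2
      exact ⟨h1.1.congr h2, fun x hx v => by rw [theta_congr Q h1.1 h2 hx, h1.2 x hx]⟩
  refine ⟨⟨T, fun i x hx => ?_, fun i x hx => ?_⟩, fun i j x hi hj => ?_, fun i x hi v => ?_⟩
  · have hx' : x ∈ Opens.comap (toCont Φ) (𝒰.U i) ⊓ 𝒱.U (κ x) := ⟨hx, hκ x⟩
    exact (((hTloc i (κ x)).1 x hx').contMDiffAt
      ((Opens.comap (toCont Φ) (𝒰.U i) ⊓ 𝒱.U (κ x)).isOpen.mem_nhds hx')).contMDiffWithinAt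
  · exact smul_ne_zero (hμ0 _ _ _ hx (hVU _ x (hκ x))) (hτ0 _ x (hκ x))
  · change quot (T i x) (T j x) = μ i j x
    refine ((eq_quot_iff _ (smul_ne_zero (hμ0 _ _ _ hj (hVU _ x (hκ x))) (hτ0 _ x (hκ x))) _).2
      ?_).symm
    rw [smul_smul, hμ _ _ _ _ hj]
  · exact (hTloc i (κ x)).2 x ⟨hi, hκ x⟩ v

end LineBundle

end Prequantum

end

theorem theorem1
    {E : Type*} [NormedAddCommGroup E] [NormedSpace ℝ E] [FiniteDimensional ℝ E]
    {M : Type*} [TopologicalSpace M] [T2Space M] [SecondCountableTopology M]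
    [ChartedSpace E M] [IsManifold 𝓘(ℝ, E) ∞ M]
    (Ω : Prequantum.SymplecticForm E M)
    (L : M → Type*) [TopologicalSpace (TotalSpace ℂ L)]
    [∀ x, AddCommGroup (L x)] [∀ x, Module ℂ (L x)] [∀ x, TopologicalSpace (L x)]
    [∀ x, IsTopologicalAddGroup (L x)] [∀ x, ContinuousSMul ℝ (L x)]
    [FiberBundle ℂ L] [VectorBundle ℝ ℂ L] [VectorBundle ℂ ℂ L]
    [ContMDiffVectorBundle ∞ ℂ L 𝓘(ℝ, E)]
    (Q : Prequantum.PrequantumStructure L Ω)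
    (P : ∀ x : M, Submodule ℝ (TangentSpace 𝓘(ℝ, E) x))
    (hP : Prequantum.IsPolarization Ω P)
    (Φ : M ≃ₘ⟮𝓘(ℝ, E), 𝓘(ℝ, E)⟯ M) (hΦ : Prequantum.IsSymplectomorphism Ω Φ)
    (hH : Subsingleton (Cech.H (Cech.constUnits M) 1)) :
    Prequantum.IsPolarization Ω (Prequantum.pullbackPolarization Φ P) ∧
    (∃ 𝒰 : Cech.OpenCover M, Nonempty (Prequantum.Trivializations E L 𝒰)) ∧
    ∀ (𝒰 : Cech.OpenCover M) (S : Prequantum.Trivializations E L 𝒰),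
      (∃ T, Prequantum.IsComplementary Q Φ S T) ∧
      ∀ T, Prequantum.IsComplementary Q Φ S T →
        ∃ e : Prequantum.SheafQuantization Q P ≃ₗ[ℂ]
            Prequantum.SheafQuantization Q (Prequantum.pullbackPolarization Φ P),
          Prequantum.IsInducedBy Q P Φ S T e := by
  refine ⟨?_, Prequantum.exists_trivializations E L, fun 𝒰 S =>
    ⟨Prequantum.exists_isComplementary Q hΦ S, fun T hT => hT.exists_isInducedBy hP hΦ⟩⟩
  have : CompleteSpace E := FiniteDimensional.complete ℝ E
  exact hP.pullback Φ hΦ
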